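/- Let $M$ be a compact smooth manifold with (possibly empty) boundary $\partial M$, let $I=[0,1]$, and let $\mathbb{R}^\infty=\bigcup_N\mathbb{R}^N$ be the space of real sequences with finitely many nonzero entries. Fix a smooth embedding $e:M\to\mathbb{R}^d$ and let $\bar e:M\times I\to\mathbb{R}^\infty$ be the embedding $\bar e(x,t)=(e(x),t,0,0,\dots)$. A smooth embedding $M\times I\to\mathbb{R}^\infty$ is a map that takes values in some $\mathbb{R}^N$ and is a smooth embedding (a smooth topological embedding with everywhere injective differential) into that $\mathbb{R}^N$. Let $\mathrm{Emb}_\sqcup(M\times I,\mathbb{R}^\infty)$ be the set of smooth embeddings $\phi:M\times I\to\mathbb{R}^\infty$ such that 1. the $\infty$-jets of $\phi$ and $\bar e$ agree at every point of $M\times\{0\}$; 2. the $\infty$-jets of $\phi$ and $\bar e$ agree at every point of $\partial M\times I$ (no condition if $\partial M=\emptyset$); 3. there is a vector $v\in\mathbb{R}^\infty$, not contained in the tangent space $d(\phi(\cdot,1))_x(T_xM)$ for any $x\in M$, such that the $\infty$-jets of $\phi$ and of $(x,t)\mapsto\phi(x,1)+(t-1)v$ agree at every point of $M\times\{1\}$.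 Let $\mathrm{Emb}_\partial(M\times I,\mathbb{R}^\infty)\subset\mathrm{Emb}_\sqcup(M\times I,\mathbb{R}^\infty)$ be the subset of those $\phi$ whose $\infty$-jet agrees with that of $\bar e$ also at every point of $M\times\{1\}$. Both sets carry the direct limit topology of their subsets of embeddings into $\mathbb{R}^N$, $N\in\mathbb{N}$, each with the $C^\infty$ topology. Then $\mathrm{Emb}_\sqcup(M\times I,\mathbb{R}^\infty)$ and $\mathrm{Emb}_\partial(M\times I,\mathbb{R}^\infty)$ are contractible. -/

import Mathlib

open scoped Manifold ContDiff

noncomputable section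

namespace ConcordanceEmb

/-- `ℝ^∞ = ⋃ ℝ^N`: real sequences with finitely many nonzero entries. -/
abbrev RInf : Type := ℕ →₀ ℝ

/-- The standard inclusion `ℝ^N = ℝ^N × {0} ⊆ ℝ^∞` as the first `N` coordinates. -/
def inclRInf (N : ℕ) (x : EuclideanSpace ℝ (Fin N)) : RInf :=
  Finsupp.onFinset (Finset.range N) (fun i => if h : i < N then x ⟨i, h⟩ else 0) (by
    intro i hi
    by_contra hN
    exact hi (dif_neg (by simpa using hN)))

section General

variable {E : Type*} [NormedAddCommGroup E] [NormedSpace ℝ E]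
  {H : Type*} [TopologicalSpace H] (J : ModelWithCorners ℝ E H)
  {X : Type*} [TopologicalSpace X] [ChartedSpace H X]
  {F : Type*} [NormedAddCommGroup F] [NormedSpace ℝ F]

/-- Smooth embeddings into a vector space: smooth topological embeddings whose differential is
injective at every point. -/
def IsSmoothEmb (f : X → F) : Prop :=
  ContMDiff J 𝓘(ℝ, F) ∞ f ∧
    (∀ p : X, Function.Injective (mfderiv J 𝓘(ℝ, F) f p)) ∧
    Topology.IsEmbedding f

/-- Smooth embeddings into `ℝ^∞`: the image lies in some `ℝ^N` and the map is a smooth embedding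
into that `ℝ^N`. -/
def IsSmoothEmbRInf (φ : X → RInf) : Prop :=
  ∃ (N : ℕ) (f : X → EuclideanSpace ℝ (Fin N)), IsSmoothEmb J f ∧ φ = inclRInf N ∘ f

/-- The maps `f` and `g` have the same `∞`-jet at `p`: in the chart at `p` their derivatives of
all orders (order `0` included) coincide at `p`. -/
def SameJet (f g : X → F) (p : X) : Prop :=
  ∀ k : ℕ,
    iteratedFDerivWithin ℝ k (f ∘ (extChartAt J p).symm) (Set.range J) (extChartAt J p p) =
      iteratedFDerivWithin ℝ k (g ∘ (extChartAt J p).symm) (Set.range J) (extChartAt J p p)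

/-- Equality of `∞`-jets at `p` for `ℝ^∞`-valued maps, that is, coordinate by coordinate. -/
def SameJetRInf (φ ψ : X → RInf) (p : X) : Prop :=
  ∀ i : ℕ, SameJet J (fun q => φ q i) (fun q => ψ q i) p

variable (X F) in
/-- The (weak) `C^∞` topology: uniform convergence, on compact subsets of the chart domains, of
the derivatives of all orders in these charts. It is defined on all functions, but only used on
sets of smooth functions. -/
@[reducible]
def smoothTopology : TopologicalSpace (X → F) :=
  ⨅ (p : X) (k : ℕ), TopologicalSpace.induced
    (fun f : X → F =>
      UniformOnFun.ofFun {K : Set E | IsCompact K ∧ K ⊆ (extChartAt J p).target}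
        (iteratedFDerivWithin ℝ k (f ∘ (extChartAt J p).symm) (Set.range J)))
    inferInstance

/-- The members of a set `S` of `ℝ^∞`-valued maps that take values in `ℝ^N`. -/
def Stage (S : Set (X → RInf)) (N : ℕ) : Type _ :=
  {f : X → EuclideanSpace ℝ (Fin N) // inclRInf N ∘ f ∈ S}

/-- Each stage carries the `C^∞` topology. -/
@[reducible]
def stageTopology (S : Set (X → RInf)) (N : ℕ) : TopologicalSpace (Stage S N) :=
  TopologicalSpace.induced (fun f : Stage S N => f.1)
    (smoothTopology J X (EuclideanSpace ℝ (Fin N)))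

/-- The topology on a set `S` of smooth maps to `ℝ^∞ = ⋃ ℝ^N`, as the direct limit of its stages
with their `C^∞` topologies: a set is open iff its preimage in every stage is open. -/
@[reducible]
def directLimitTopology (S : Set (X → RInf)) : TopologicalSpace S :=
  ⨆ N : ℕ, TopologicalSpace.coinduced
    (fun f : Stage S N => (⟨inclRInf N ∘ f.1, f.2⟩ : S)) (stageTopology J S N)

end General

section Cylinder

variable {E : Type*} [NormedAddCommGroup E] [NormedSpace ℝ E]
  {H : Type*} [TopologicalSpace H] (I : ModelWithCorners ℝ E H)
  {M : Type*} [TopologicalSpace M] [ChartedSpace H M] {d : ℕ}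

/-- The map `ē(x, t) = (e(x), t, 0, 0, …)`. -/
def stdCylinder (e : M → EuclideanSpace ℝ (Fin d)) (p : M × unitInterval) : RInf :=
  inclRInf d (e p.1) + Finsupp.single d (p.2 : ℝ)

/-- The top of `φ` is product-like: for some vector `v`, tangent to the image of `φ(·, 1)` at no
point, the `∞`-jets of `φ` and of `(x, t) ↦ φ(x, 1) + (t - 1) v` coincide along `M × {1}`. -/
def ProductLikeTop (φ : M × unitInterval → RInf) : Prop :=
  ∃ v : RInf,
    (∀ (x : M) (u : TangentSpace I x),
      ¬ ∀ i : ℕ, mfderiv I 𝓘(ℝ, ℝ) (fun y : M => φ (y, 1) i) x u = v i) ∧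
    ∀ x : M, SameJetRInf (I.prod (𝓡∂ 1)) φ
      (fun q => φ (q.1, 1) + ((q.2 : ℝ) - 1) • v) (x, 1)

/-- The underlying set of `Emb_⊔(M × [0,1], ℝ^∞)`. -/
def embSqcupSet (e : M → EuclideanSpace ℝ (Fin d)) : Set (M × unitInterval → RInf) :=
  {φ | IsSmoothEmbRInf (I.prod (𝓡∂ 1)) φ ∧
    (∀ x : M, SameJetRInf (I.prod (𝓡∂ 1)) φ (stdCylinder e) (x, 0)) ∧
    (∀ x ∈ I.boundary M, ∀ t : unitInterval,
      SameJetRInf (I.prod (𝓡∂ 1)) φ (stdCylinder e) (x, t)) ∧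
    ProductLikeTop I φ}

/-- The underlying set of `Emb_∂(M × [0,1], ℝ^∞)`. -/
def embBdrySet (e : M → EuclideanSpace ℝ (Fin d)) : Set (M × unitInterval → RInf) :=
  {φ | φ ∈ embSqcupSet I e ∧
    ∀ x : M, SameJetRInf (I.prod (𝓡∂ 1)) φ (stdCylinder e) (x, 1)}

/-- The space `Emb_⊔(M × [0,1], ℝ^∞)`. -/
def EmbSqcup (e : M → EuclideanSpace ℝ (Fin d)) : Type _ := embSqcupSet I e

/-- The space `Emb_∂(M × [0,1], ℝ^∞)`. -/
def EmbBdry (e : M → EuclideanSpace ℝ (Fin d)) : Type _ := embBdrySet I e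

instance (e : M → EuclideanSpace ℝ (Fin d)) : TopologicalSpace (EmbSqcup I e) :=
  directLimitTopology (I.prod (𝓡∂ 1)) (embSqcupSet I e)

instance (e : M → EuclideanSpace ℝ (Fin d)) : TopologicalSpace (EmbBdry I e) :=
  directLimitTopology (I.prod (𝓡∂ 1)) (embBdrySet I e)

end Cylinder

end ConcordanceEmb

end

/-! The proof exploits the infinitely many spare coordinates of `RInf`, as in the classical
contractibility of embedding spaces into ℝ^∞. Both spaces are instances of one set `embSet I e b`,
where `b` says whether jets are also prescribed at the top. A map is admissible if it is smooth, has
the prescribed jets along `fixedLocus` and is product-like at the top. These conditions are affine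
in the map and its top direction jointly, so straight lines between admissible maps stay admissible,
and only injectivity and immersivity need care. Non-tangency of the top direction is automatic for
an embedding (`productLikeTop_iff`).

The homotopy is a concatenation of three straight lines: from `φ` to `shift d K ∘ φ`, which vacates
the coordinates `d + 1, …, d + K` and fixes the standard cylinder; on to `shift d K ∘ φ + G`, where
`G` occupies the vacated coordinates; and finally to the constant value `stdCylinder e + G`. On the
first line embeddedness follows by looking at the last nonzero coordinate (`shift_line_eq_zero`). On
the second, `φ` can be read off the coordinates that `G` does not touch
(`IsAuxiliary.shift_add_mem`). On the third, embeddedness comes from `G` off the fixed locus and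
from the prescribed jets on it (`IsAuxiliary.mem_of_coord_eq`).

The auxiliary map `G` (`exists_auxiliary_coordinates`) is built from a function `ρ` that is flat
along the fixed locus and nonzero elsewhere, multiplied by functions that embed the cylinder away
from the top. One more coordinate detects the vertical direction at the top, where it is allowed to;
where it is not, the prescribed jets force coordinate `d` to do so. Continuity in the direct limit
topology is checked stage by stage (`continuous_line`). -/

noncomputable section

namespace ConcordanceEmb

open Set Topology Filter

/-! ### Calculus of ∞-jets in charts. -/

section Jets

variable {E : Type*} [NormedAddCommGroup E] [NormedSpace ℝ E]
  {H : Type*} [TopologicalSpace H] {J : ModelWithCorners ℝ E H}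
  {X : Type*} [TopologicalSpace X] [ChartedSpace H X]
  {F : Type*} [NormedAddCommGroup F] [NormedSpace ℝ F]
  {V : Type*} [NormedAddCommGroup V] [NormedSpace ℝ V]

/-- A smooth map is smooth, within the range of the model, when read in a chart. -/
lemma contDiffWithinAt_comp_extChartAt_symm [IsManifold J ∞ X] {f : X → F}
    (hf : ContMDiff J 𝓘(ℝ, F) ∞ f) (p : X) {y : E} (hy : y ∈ (extChartAt J p).target) :
    ContDiffWithinAt ℝ ∞ (f ∘ (extChartAt J p).symm) (range J) y := by
  have h : ContMDiffOn 𝓘(ℝ, E) 𝓘(ℝ, F) ∞ (f ∘ (extChartAt J p).symm) (extChartAt J p).target :=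
    hf.comp_contMDiffOn (contMDiffOn_extChartAt_symm p)
  exact (h.contDiffOn y hy).mono_of_mem_nhdsWithin (extChartAt_target_mem_nhdsWithin_of_mem hy)

variable (J) in
/-- The derivative of a vector-valued map at `p` in the direction `u`. -/
def dirDeriv (f : X → F) (p : X) (u : E) : F := mfderiv J 𝓘(ℝ, F) f p u

lemma _root_.MDifferentiableAt.dirDeriv_eq_fderivWithin {f : X → F} {p : X}
    (hf : MDifferentiableAt J 𝓘(ℝ, F) f p) (u : E) :
    dirDeriv J f p u =
      fderivWithin ℝ (f ∘ (extChartAt J p).symm) (range J) (extChartAt J p p) u := by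
  rw [dirDeriv, hf.mfderiv]
  rfl

namespace SameJet

variable {f g f₁ f₂ g₁ g₂ : X → F} {p : X}

lemma refl (f : X → F) (p : X) : SameJet J f f p := fun _ => rfl

lemma trans {f₃ : X → F} (h : SameJet J f₁ f₂ p) (h' : SameJet J f₂ f₃ p) : SameJet J f₁ f₃ p :=
  fun k => (h k).trans (h' k)

lemma apply_eq (h : SameJet J f g p) : f p = g p := by
  have := congrArg (fun m => m 0) (h 0)
  simpa using this

lemma prodMk [IsManifold J ∞ X] {h₁ h₂ : X → V}
    (hf₁ : ContMDiff J 𝓘(ℝ, F) ∞ f₁) (hf₂ : ContMDiff J 𝓘(ℝ, F) ∞ f₂)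
    (hh₁ : ContMDiff J 𝓘(ℝ, V) ∞ h₁) (hh₂ : ContMDiff J 𝓘(ℝ, V) ∞ h₂)
    (hf : SameJet J f₁ f₂ p) (hh : SameJet J h₁ h₂ p) :
    SameJet J (fun q => (f₁ q, h₁ q)) (fun q => (f₂ q, h₂ q)) p := by
  intro k
  have hp := mem_extChartAt_target (I := J) p
  have hr := extChartAt_target_subset_range p hp
  have hk : (k : WithTop ℕ∞) ≤ ∞ := by exact_mod_cast le_top
  have e₁ := iteratedFDerivWithin_prodMk (contDiffWithinAt_comp_extChartAt_symm hf₁ p hp)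
    (contDiffWithinAt_comp_extChartAt_symm hh₁ p hp) J.uniqueDiffOn hr hk
  have e₂ := iteratedFDerivWithin_prodMk (contDiffWithinAt_comp_extChartAt_symm hf₂ p hp)
    (contDiffWithinAt_comp_extChartAt_symm hh₂ p hp) J.uniqueDiffOn hr hk
  rw [hf k, hh k, ← e₂] at e₁
  exact e₁

/-- The jet of a composition only depends on the jets of the factors. -/
lemma comp [IsManifold J ∞ X] {h₁ h₂ : F → V}
    (hf₁ : ContMDiff J 𝓘(ℝ, F) ∞ f₁) (hf₂ : ContMDiff J 𝓘(ℝ, F) ∞ f₂)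
    (hh₁ : ContDiff ℝ ∞ h₁) (hh₂ : ContDiff ℝ ∞ h₂)
    (hf : SameJet J f₁ f₂ p)
    (hh : ∀ k, iteratedFDeriv ℝ k h₁ (f₁ p) = iteratedFDeriv ℝ k h₂ (f₁ p)) :
    SameJet J (fun q => h₁ (f₁ q)) (fun q => h₂ (f₂ q)) p := by
  intro k
  have hp := mem_extChartAt_target (I := J) p
  have hr := extChartAt_target_subset_range p hp
  have hk : (k : WithTop ℕ∞) ≤ ∞ := by exact_mod_cast le_top
  -- By Faà di Bruno's formula the derivative of the composite depends only on the two Taylor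
  -- series, which agree by hypothesis.
  have e₁ := iteratedFDerivWithin_comp (t := univ) (i := k) (n := ∞)
    (x := extChartAt J p p) (f := f₁ ∘ (extChartAt J p).symm) hh₁.contDiffAt.contDiffWithinAt
    (contDiffWithinAt_comp_extChartAt_symm hf₁ p hp) uniqueDiffOn_univ J.uniqueDiffOn hr
    (mapsTo_univ _ _) hk
  have e₂ := iteratedFDerivWithin_comp (t := univ) (i := k) (n := ∞)
    (x := extChartAt J p p) (f := f₂ ∘ (extChartAt J p).symm) hh₂.contDiffAt.contDiffWithinAt
    (contDiffWithinAt_comp_extChartAt_symm hf₂ p hp) uniqueDiffOn_univ J.uniqueDiffOn hr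
    (mapsTo_univ _ _) hk
  have hF : ftaylorSeriesWithin ℝ (f₁ ∘ (extChartAt J p).symm) (range J) (extChartAt J p p) =
      ftaylorSeriesWithin ℝ (f₂ ∘ (extChartAt J p).symm) (range J) (extChartAt J p p) :=
    funext fun k => hf k
  have hH : ftaylorSeriesWithin ℝ h₁ univ ((f₁ ∘ (extChartAt J p).symm) (extChartAt J p p)) =
      ftaylorSeriesWithin ℝ h₂ univ ((f₂ ∘ (extChartAt J p).symm) (extChartAt J p p)) := by
    simp only [Function.comp_apply, extChartAt_to_inv, ← hf.apply_eq, ftaylorSeriesWithin_univ]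
    exact funext fun k => hh k
  rw [hF, hH, ← e₂] at e₁
  exact e₁

lemma comp_left [IsManifold J ∞ X] {h : F → V}
    (hf₁ : ContMDiff J 𝓘(ℝ, F) ∞ f₁) (hf₂ : ContMDiff J 𝓘(ℝ, F) ∞ f₂)
    (hh : ContDiff ℝ ∞ h) (hf : SameJet J f₁ f₂ p) :
    SameJet J (fun q => h (f₁ q)) (fun q => h (f₂ q)) p :=
  comp hf₁ hf₂ hh hh hf fun _ => rfl

lemma add [IsManifold J ∞ X]
    (hf₁ : ContMDiff J 𝓘(ℝ, F) ∞ f₁) (hf₂ : ContMDiff J 𝓘(ℝ, F) ∞ f₂)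
    (hg₁ : ContMDiff J 𝓘(ℝ, F) ∞ g₁) (hg₂ : ContMDiff J 𝓘(ℝ, F) ∞ g₂)
    (hf : SameJet J f₁ f₂ p) (hg : SameJet J g₁ g₂ p) :
    SameJet J (fun q => f₁ q + g₁ q) (fun q => f₂ q + g₂ q) p :=
  comp_left (h := fun z : F × F => z.1 + z.2) (hf₁.prodMk_space hg₁) (hf₂.prodMk_space hg₂)
    (by fun_prop) (prodMk hf₁ hf₂ hg₁ hg₂ hf hg)

lemma const_smul [IsManifold J ∞ X] (c : ℝ)
    (hf₁ : ContMDiff J 𝓘(ℝ, F) ∞ f₁) (hf₂ : ContMDiff J 𝓘(ℝ, F) ∞ f₂)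
    (hf : SameJet J f₁ f₂ p) :
    SameJet J (fun q => c • f₁ q) (fun q => c • f₂ q) p :=
  comp_left (h := fun z : F => c • z) hf₁ hf₂ (by fun_prop) hf

lemma mul [IsManifold J ∞ X] {f₁ f₂ g₁ g₂ : X → ℝ}
    (hf₁ : ContMDiff J 𝓘(ℝ, ℝ) ∞ f₁) (hf₂ : ContMDiff J 𝓘(ℝ, ℝ) ∞ f₂)
    (hg₁ : ContMDiff J 𝓘(ℝ, ℝ) ∞ g₁) (hg₂ : ContMDiff J 𝓘(ℝ, ℝ) ∞ g₂)
    (hf : SameJet J f₁ f₂ p) (hg : SameJet J g₁ g₂ p) :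
    SameJet J (fun q => f₁ q * g₁ q) (fun q => f₂ q * g₂ q) p :=
  comp_left (h := fun z : ℝ × ℝ => z.1 * z.2) (hf₁.prodMk_space hg₁) (hf₂.prodMk_space hg₂)
    (by fun_prop) (prodMk hf₁ hf₂ hg₁ hg₂ hf hg)

lemma dirDeriv_eq (hf : MDifferentiableAt J 𝓘(ℝ, F) f p) (hg : MDifferentiableAt J 𝓘(ℝ, F) g p)
    (h : SameJet J f g p) (u : E) : dirDeriv J f p u = dirDeriv J g p u := by
  have h1 := congrArg (fun m => m (fun _ => u)) (h 1)
  have hr := extChartAt_target_subset_range p (mem_extChartAt_target (I := J) p)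
  simp only [iteratedFDerivWithin_one_apply (J.uniqueDiffOn _ hr)] at h1
  rw [hf.dirDeriv_eq_fderivWithin, hg.dirDeriv_eq_fderivWithin]
  exact h1

end SameJet

/-- Two smooth functions that agree on a set with the unique differentiability property have the
same derivatives of all orders on that set. -/
lemma iteratedFDeriv_eq_of_eqOn {h₁ h₂ : F → V} (hh₁ : ContDiff ℝ ∞ h₁) (hh₂ : ContDiff ℝ ∞ h₂)
    {s : Set F} (hs : UniqueDiffOn ℝ s) (h : EqOn h₁ h₂ s) {x : F} (hx : x ∈ s) (k : ℕ) :
    iteratedFDeriv ℝ k h₁ x = iteratedFDeriv ℝ k h₂ x := by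
  have hk : (k : WithTop ℕ∞) ≤ ∞ := by exact_mod_cast le_top
  rw [← iteratedFDerivWithin_eq_iteratedFDeriv hs (hh₁.of_le hk).contDiffAt hx,
    ← iteratedFDerivWithin_eq_iteratedFDeriv hs (hh₂.of_le hk).contDiffAt hx,
    iteratedFDerivWithin_congr h hx]

end Jets

/-! ### Continuous families of smooth maps in the `C^∞` topology. -/

section Families

variable {E : Type*} [NormedAddCommGroup E] [NormedSpace ℝ E]
  {H : Type*} [TopologicalSpace H] {J : ModelWithCorners ℝ E H}
  {X : Type*} [TopologicalSpace X] [ChartedSpace H X] [IsManifold J ∞ X]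
  {F : Type*} [NormedAddCommGroup F] [NormedSpace ℝ F]
  {V : Type*} [NormedAddCommGroup V] [NormedSpace ℝ V]
  {Z : Type*} [TopologicalSpace Z]

/-- The `k`-th derivative of a smooth map in a chart, as a continuous map on a subset of the
target of the chart. -/
def jetOn (f : X → F) (hf : ContMDiff J 𝓘(ℝ, F) ∞ f) (p : X) (k : ℕ) {K : Set E}
    (hK : K ⊆ (extChartAt J p).target) : C(K, E [×k]→L[ℝ] F) where
  toFun y := iteratedFDerivWithin ℝ k (f ∘ (extChartAt J p).symm) (range J) y
  continuous_toFun := by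
    have h : ContinuousOn (iteratedFDerivWithin ℝ k (f ∘ (extChartAt J p).symm) (range J)) K := by
      intro y hy
      have := (contDiffWithinAt_comp_extChartAt_symm hf p (hK hy)).iteratedFDerivWithin_right
        (m := 0) (i := k) J.uniqueDiffOn (by simp; exact_mod_cast le_top)
        (extChartAt_target_subset_range p (hK hy))
      exact this.continuousWithinAt.mono (hK.trans (extChartAt_target_subset_range p))
    exact h.domRestrict

variable (J) in
/-- A continuous family of smooth maps. -/
structure IsSmoothFamily (u : Z → X → F) : Prop where
  smooth : ∀ z, ContMDiff J 𝓘(ℝ, F) ∞ (u z)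
  continuous_jetOn : ∀ (p : X) (k : ℕ) (K : Set E) (hK : K ⊆ (extChartAt J p).target),
    IsCompact K → Continuous fun z => jetOn (u z) (smooth z) p k hK

/-- Uniform convergence on a compact set is convergence in `C(K, ·)`. Passing to that space makes
sums, scalings by continuous functions and postcomposition with linear maps visibly continuous. -/
lemma continuous_jetOn_iff {u : Z → X → F} (hu : ∀ z, ContMDiff J 𝓘(ℝ, F) ∞ (u z)) (p : X) (k : ℕ)
    {K : Set E} (hK : K ⊆ (extChartAt J p).target) (hc : IsCompact K) :
    (Continuous fun z => jetOn (u z) (hu z) p k hK) ↔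
      ∀ z₀, TendstoUniformlyOn
        (fun z => iteratedFDerivWithin ℝ k (u z ∘ (extChartAt J p).symm) (range J))
        (iteratedFDerivWithin ℝ k (u z₀ ∘ (extChartAt J p).symm) (range J)) (𝓝 z₀) K := by
  have := isCompact_iff_compactSpace.mp hc
  simp only [continuous_iff_continuousAt, ContinuousAt, ContinuousMap.tendsto_iff_tendstoUniformly,
    tendstoUniformlyOn_iff_tendstoUniformly_comp_coe]
  rfl

/-- Continuity for the `C^∞` topology is continuity of all derivatives in all charts. -/
lemma isSmoothFamily_iff {u : Z → X → F} :
    IsSmoothFamily J u ↔ (∀ z, ContMDiff J 𝓘(ℝ, F) ∞ (u z)) ∧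
      @Continuous Z (X → F) _ (smoothTopology J X F) u := by
  have key (hu : ∀ z, ContMDiff J 𝓘(ℝ, F) ∞ (u z)) :
      @Continuous Z (X → F) _ (smoothTopology J X F) u ↔
      ∀ (p : X) (k : ℕ) (K : Set E) (hK : K ⊆ (extChartAt J p).target),
        IsCompact K → Continuous fun z => jetOn (u z) (hu z) p k hK := by
    rw [smoothTopology]
    simp only [continuous_iInf_rng, continuous_induced_rng]
    refine forall₂_congr fun p k => ?_
    rw [continuous_iff_continuousAt]
    simp only [ContinuousAt, UniformOnFun.tendsto_iff_tendstoUniformlyOn]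
    constructor
    · intro h K hK hc
      exact (continuous_jetOn_iff hu p k hK hc).2 fun z₀ => h z₀ K ⟨hc, hK⟩
    · intro h z₀ K hK
      exact (continuous_jetOn_iff hu p k hK.2 hK.1).1 (h K hK.2 hK.1) z₀
  constructor
  · rintro ⟨h1, h2⟩
    exact ⟨h1, (key h1).2 h2⟩
  · rintro ⟨h1, h2⟩
    exact ⟨h1, (key h1).1 h2⟩

namespace IsSmoothFamily

variable {u v : Z → X → F}

lemma const {f : X → F} (hf : ContMDiff J 𝓘(ℝ, F) ∞ f) : IsSmoothFamily J fun _ : Z => f :=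
  ⟨fun _ => hf, fun _ _ _ _ _ => continuous_const⟩

lemma add (hu : IsSmoothFamily J u) (hv : IsSmoothFamily J v) :
    IsSmoothFamily J fun z q => u z q + v z q := by
  refine ⟨fun z => (hu.smooth z).add (hv.smooth z), fun p k K hK hc => ?_⟩
  refine ((hu.continuous_jetOn p k K hK hc).add (hv.continuous_jetOn p k K hK hc)).congr ?_
  intro z
  ext1 y
  have hk : (k : WithTop ℕ∞) ≤ ∞ := by exact_mod_cast le_top
  exact (iteratedFDerivWithin_add_apply
    ((contDiffWithinAt_comp_extChartAt_symm (hu.smooth z) p (hK y.2)).of_le hk)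
    ((contDiffWithinAt_comp_extChartAt_symm (hv.smooth z) p (hK y.2)).of_le hk)
    J.uniqueDiffOn (extChartAt_target_subset_range p (hK y.2))).symm

lemma smul (hu : IsSmoothFamily J u) {c : Z → ℝ} (hc : Continuous c) :
    IsSmoothFamily J fun z q => c z • u z q := by
  refine ⟨fun z => (contDiff_const_smul (c z)).contMDiff.comp (hu.smooth z), fun p k K hK hK' => ?_⟩
  refine (hc.smul (hu.continuous_jetOn p k K hK hK')).congr ?_
  intro z
  ext1 y
  have hk : (k : WithTop ℕ∞) ≤ ∞ := by exact_mod_cast le_top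
  exact (iteratedFDerivWithin_const_smul_apply
    ((contDiffWithinAt_comp_extChartAt_symm (hu.smooth z) p (hK y.2)).of_le hk)
    J.uniqueDiffOn (extChartAt_target_subset_range p (hK y.2))).symm

lemma clm_comp (hu : IsSmoothFamily J u) (L : F →L[ℝ] V) :
    IsSmoothFamily J fun z q => L (u z q) := by
  refine ⟨fun z => L.contDiff.contMDiff.comp (hu.smooth z), fun p k K hK hK' => ?_⟩
  let C : C(E [×k]→L[ℝ] F, E [×k]→L[ℝ] V) :=
    ⟨fun m => L.compContinuousMultilinearMap m,
      (ContinuousLinearMap.compContinuousMultilinearMapL ℝ (fun _ : Fin k => E) F V L).continuous⟩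
  refine ((ContinuousMap.continuous_postcomp C).comp
    (hu.continuous_jetOn p k K hK hK')).congr ?_
  intro z
  ext1 y
  have hk : (k : WithTop ℕ∞) ≤ ∞ := by exact_mod_cast le_top
  exact (L.iteratedFDerivWithin_comp_left
    (contDiffWithinAt_comp_extChartAt_symm (hu.smooth z) p (hK y.2))
    J.uniqueDiffOn (extChartAt_target_subset_range p (hK y.2)) hk).symm

end IsSmoothFamily

end Families

/-! ### Coordinates on ℝ^∞ and a coordinatewise criterion for smooth embeddings. -/

section Coordinates

lemma inclRInf_apply (N : ℕ) (x : EuclideanSpace ℝ (Fin N)) (i : ℕ) :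
    inclRInf N x i = if h : i < N then x ⟨i, h⟩ else 0 := rfl

lemma inclRInf_of_le {N i : ℕ} (h : N ≤ i) (x : EuclideanSpace ℝ (Fin N)) :
    inclRInf N x i = 0 := by
  rw [inclRInf_apply, dif_neg (not_lt.2 h)]

@[simp]
lemma inclRInf_fin {N : ℕ} (x : EuclideanSpace ℝ (Fin N)) (i : Fin N) :
    inclRInf N x i = x i := by
  rw [inclRInf_apply, dif_pos i.2]

/-- The inclusion `ℝ^N ⊆ ℝ^∞` as a linear map. -/
def inclLinear (N : ℕ) : EuclideanSpace ℝ (Fin N) →ₗ[ℝ] RInf where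
  toFun := inclRInf N
  map_add' x y := by
    ext i
    by_cases h : i < N <;> simp [inclRInf_apply, h]
  map_smul' c x := by
    ext i
    by_cases h : i < N <;> simp [inclRInf_apply, h]

@[simp]
lemma inclLinear_apply (N : ℕ) (x : EuclideanSpace ℝ (Fin N)) : inclLinear N x = inclRInf N x := rfl

/-- The projection of `ℝ^∞` to its first `N` coordinates. -/
def projRInf (N : ℕ) : RInf →ₗ[ℝ] EuclideanSpace ℝ (Fin N) where
  toFun x := WithLp.toLp 2 fun i => x i
  map_add' x y := by ext i; simp
  map_smul' c x := by ext i; simp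

@[simp]
lemma projRInf_apply (N : ℕ) (x : RInf) (i : Fin N) : projRInf N x i = x i := rfl

@[simp]
lemma projRInf_inclRInf (N : ℕ) (x : EuclideanSpace ℝ (Fin N)) :
    projRInf N (inclRInf N x) = x := by
  ext i
  simp

lemma inclRInf_projRInf {N : ℕ} {x : RInf} (hx : ∀ i, N ≤ i → x i = 0) :
    inclRInf N (projRInf N x) = x := by
  ext i
  by_cases h : i < N
  · simp [inclRInf_apply, h]
  · rw [inclRInf_of_le (not_lt.1 h), hx i (not_lt.1 h)]

lemma exists_forall_le_apply_eq_zero (x : RInf) : ∃ N, ∀ i, N ≤ i → x i = 0 := by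
  refine ⟨x.support.sup id + 1, fun i hi => ?_⟩
  by_contra h
  have := Finset.le_sup (f := id) (Finsupp.mem_support_iff.2 h)
  simp only [id] at this
  omega

/-- A linear endomorphism of `ℝ^∞` maps each `ℝ^N` to some `ℝ^N'`. -/
lemma exists_linear_bound (A : RInf →ₗ[ℝ] RInf) (N : ℕ) :
    ∃ N', ∀ x : RInf, (∀ i, N ≤ i → x i = 0) → ∀ i, N' ≤ i → A x i = 0 := by
  choose b hb using fun j => exists_forall_le_apply_eq_zero (A (Finsupp.single j 1))
  refine ⟨(Finset.range N).sup b, fun x hx i hi => ?_⟩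
  have h : A x = ∑ j ∈ x.support, x j • A (Finsupp.single j 1) := by
    conv_lhs => rw [← Finsupp.sum_single x, Finsupp.sum, map_sum]
    refine Finset.sum_congr rfl fun j _ => ?_
    rw [← map_smul, Finsupp.smul_single_one]
  rw [h, Finsupp.finsetSum_apply]
  refine Finset.sum_eq_zero fun j hj => ?_
  have hjN : j < N := by
    by_contra hj'
    exact Finsupp.mem_support_iff.1 hj (hx j (not_lt.1 hj'))
  rw [Finsupp.smul_apply, hb j i ((Finset.le_sup (Finset.mem_range.2 hjN)).trans hi), smul_zero]

variable {E : Type*} [NormedAddCommGroup E] [NormedSpace ℝ E]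
  {H : Type*} [TopologicalSpace H] {J : ModelWithCorners ℝ E H}
  {X : Type*} [TopologicalSpace X] [ChartedSpace H X]
  {F : Type*} [NormedAddCommGroup F] [NormedSpace ℝ F]
  {V : Type*} [NormedAddCommGroup V] [NormedSpace ℝ V]

lemma dirDeriv_comp {f : X → F} {h : F → V} {p : X} (hh : DifferentiableAt ℝ h (f p))
    (hf : MDifferentiableAt J 𝓘(ℝ, F) f p) (u : E) :
    dirDeriv J (fun q => h (f q)) p u = fderiv ℝ h (f p) (dirDeriv J f p u) := by
  have := mfderiv_comp p hh.mdifferentiableAt hf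
  rw [dirDeriv, show (fun q => h (f q)) = h ∘ f from rfl, this, mfderiv_eq_fderiv]
  rfl

lemma dirDeriv_clm (L : F →L[ℝ] V) {f : X → F} {p : X}
    (hf : MDifferentiableAt J 𝓘(ℝ, F) f p) (u : E) :
    dirDeriv J (fun q => L (f q)) p u = L (dirDeriv J f p u) := by
  rw [dirDeriv_comp L.differentiableAt hf, L.fderiv]

@[simp]
lemma dirDeriv_const (c : F) (p : X) (u : E) : dirDeriv J (fun _ : X => c) p u = 0 := by
  unfold dirDeriv
  rw [mfderiv_const]
  rfl

variable (J) in
/-- The smooth maps to some `ℝ^N ⊆ ℝ^∞`. -/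
structure IsSmoothRInf (φ : X → RInf) : Prop where
  bounded : ∃ N, ∀ p i, N ≤ i → φ p i = 0
  smooth : ∀ i, ContMDiff J 𝓘(ℝ, ℝ) ∞ fun p => φ p i

lemma IsSmoothRInf.contMDiff_projRInf {φ : X → RInf} (h : IsSmoothRInf J φ) (N : ℕ) :
    ContMDiff J 𝓘(ℝ, EuclideanSpace ℝ (Fin N)) ∞ fun p => projRInf N (φ p) := by
  have h1 : ContMDiff J 𝓘(ℝ, Fin N → ℝ) ∞ fun p => (fun i : Fin N => φ p i) :=
    contMDiff_pi_space.2 fun i => h.smooth i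
  exact (EuclideanSpace.equiv (Fin N) ℝ).symm.contDiff.contMDiff.comp h1

lemma IsSmoothRInf.mdifferentiableAt {φ : X → RInf} (h : IsSmoothRInf J φ) (i : ℕ) (p : X) :
    MDifferentiableAt J 𝓘(ℝ, ℝ) (fun q => φ q i) p :=
  (h.smooth i).mdifferentiableAt (by simp)

lemma isSmoothRInf_inclRInf {N : ℕ} {f : X → EuclideanSpace ℝ (Fin N)}
    (hf : ContMDiff J 𝓘(ℝ, EuclideanSpace ℝ (Fin N)) ∞ f) : IsSmoothRInf J (inclRInf N ∘ f) := by
  refine ⟨⟨N, fun p i hi => inclRInf_of_le hi _⟩, fun i => ?_⟩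
  by_cases h : i < N
  · have : (fun p => (inclRInf N ∘ f) p i) =
        (EuclideanSpace.proj (𝕜 := ℝ) (⟨i, h⟩ : Fin N)) ∘ f := by
      ext p
      simp [inclRInf_apply, h]
    rw [this]
    exact (EuclideanSpace.proj (𝕜 := ℝ) (⟨i, h⟩ : Fin N)).contDiff.contMDiff.comp hf
  · have : (fun p => (inclRInf N ∘ f) p i) = fun _ => (0 : ℝ) := by
      ext p
      simp [inclRInf_apply, h]
    rw [this]
    exact contMDiff_const

/-- On a compact space, smooth embeddings into `ℝ^∞` are the injective smooth maps whose
coordinate functions have no common critical direction. -/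
lemma isSmoothEmbRInf_iff [CompactSpace X] {φ : X → RInf} :
    IsSmoothEmbRInf J φ ↔ IsSmoothRInf J φ ∧ Function.Injective φ ∧
      ∀ p (u : E), (∀ i, dirDeriv J (fun q => φ q i) p u = 0) → u = 0 := by
  constructor
  · rintro ⟨N, f, ⟨hs, hi, he⟩, rfl⟩
    refine ⟨isSmoothRInf_inclRInf hs, ?_, fun p u hu => ?_⟩
    · exact (Function.LeftInverse.injective (projRInf_inclRInf N)).comp he.injective
    · refine hi p (?_ : dirDeriv J f p u = dirDeriv J f p 0)
      have h0 : dirDeriv J f p 0 = 0 := (mfderiv J 𝓘(ℝ, EuclideanSpace ℝ (Fin N)) f p).map_zero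
      rw [h0]
      ext i
      have h1 := dirDeriv_clm (EuclideanSpace.proj (𝕜 := ℝ) i)
        ((hs.mdifferentiableAt (by simp)) : MDifferentiableAt J _ f p) u
      have h2 := hu i
      simp only [Function.comp_apply, inclRInf_fin] at h2
      exact h1.symm.trans h2
  · rintro ⟨hs, hinj, hd⟩
    obtain ⟨N, hN⟩ := hs.bounded
    have hφ : φ = inclRInf N ∘ fun p => projRInf N (φ p) := by
      ext1 p
      exact (inclRInf_projRInf (hN p)).symm
    refine ⟨N, fun p => projRInf N (φ p), ⟨hs.contMDiff_projRInf N, fun p => ?_, ?_⟩, hφ⟩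
    · refine (injective_iff_map_eq_zero (mfderiv J 𝓘(ℝ, EuclideanSpace ℝ (Fin N))
        (fun p => projRInf N (φ p)) p)).2 fun (u : E) hu => hd p u fun i => ?_
      replace hu : dirDeriv J (fun p => projRInf N (φ p)) p u = 0 := hu
      by_cases h : i < N
      · have h1 := dirDeriv_clm (EuclideanSpace.proj (𝕜 := ℝ) (⟨i, h⟩ : Fin N))
          (((hs.contMDiff_projRInf N).mdifferentiableAt (by simp)) : MDifferentiableAt J _ _ p) u
        rw [hu, map_zero] at h1
        exact h1
      · have : (fun q => φ q i) = fun _ => (0 : ℝ) := funext fun q => hN q i (not_lt.1 h)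
        rw [this]
        exact dirDeriv_const (J := J) (0 : ℝ) p (u : E)
    -- A continuous injection from a compact space to a Hausdorff space is a closed embedding.
    · refine (Continuous.isClosedEmbedding (hs.contMDiff_projRInf N).continuous ?_).isEmbedding
      rw [hφ] at hinj
      exact hinj.of_comp

end Coordinates

/-! ### Continuity of homotopies for the direct limit topology. -/

section DirectLimit

variable {E : Type*} [NormedAddCommGroup E] [NormedSpace ℝ E]
  {H : Type*} [TopologicalSpace H] {J : ModelWithCorners ℝ E H}
  {X : Type*} [TopologicalSpace X] [ChartedSpace H X]

/-- To check continuity of a homotopy on a direct limit, it suffices to check it on the stages. -/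
lemma continuous_of_continuous_stage {S : Set (X → RInf)}
    (hS : ∀ φ ∈ S, IsSmoothRInf J φ) (Φ : S → unitInterval → S)
    (h : ∀ N, letI := directLimitTopology J S; letI := stageTopology J S N
      Continuous fun z : Stage S N × unitInterval => Φ ⟨inclRInf N ∘ z.1.1, z.1.2⟩ z.2) :
    letI := directLimitTopology J S
    Continuous fun z : S × unitInterval => Φ z.1 z.2 := by
  let _ := directLimitTopology J S
  have hc : ∀ φ : S, Continuous (Φ φ) := by
    rintro ⟨φ, hφ⟩
    obtain ⟨N, hN⟩ := (hS φ hφ).bounded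
    let _ := stageTopology J S N
    have e : inclRInf N ∘ (fun p => projRInf N (φ p)) = φ :=
      funext fun p => inclRInf_projRInf (hN p)
    let f : Stage S N := ⟨fun p => projRInf N (φ p), by rw [e]; exact hφ⟩
    refine ((h N).comp (Continuous.prodMk_right f)).congr fun s => ?_
    simp only [Function.comp_apply, f]
    congr 2
  -- The product of a direct limit with the interval need not visibly be the direct limit of the
  -- products. Currying avoids this: a map out of `S` into the path space can be tested on stages,
  -- and evaluation of paths is continuous because the interval is locally compact.
  let Ψ : S → C(unitInterval, S) := fun φ => ⟨Φ φ, hc φ⟩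
  have hΨ : Continuous Ψ := by
    refine continuous_iSup_dom.2 fun N => continuous_coinduced_dom.2 ?_
    let _ := stageTopology J S N
    exact (ContinuousMap.curry ⟨_, h N⟩).continuous
  exact (hΨ.comp continuous_fst).eval continuous_snd

/-- The straight line homotopy between two maps of the form `φ ↦ A ∘ φ + g` is continuous for the
direct limit topology. -/
lemma continuous_line [IsManifold J ∞ X] {S : Set (X → RInf)} (hS : ∀ φ ∈ S, IsSmoothRInf J φ)
    (A B : RInf →ₗ[ℝ] RInf) {g h : X → RInf} (hg : IsSmoothRInf J g) (hh : IsSmoothRInf J h)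
    (Φ : S → unitInterval → S)
    (hΦ : ∀ φ s p, (Φ φ s).1 p =
      (1 - (s : ℝ)) • (A (φ.1 p) + g p) + (s : ℝ) • (B (φ.1 p) + h p)) :
    letI := directLimitTopology J S
    Continuous fun z : S × unitInterval => Φ z.1 z.2 := by
  refine continuous_of_continuous_stage hS Φ fun N => ?_
  let _ := directLimitTopology J S
  let _ := stageTopology J S N
  obtain ⟨N₁, h₁⟩ := exists_linear_bound A N
  obtain ⟨N₂, h₂⟩ := exists_linear_bound B N
  obtain ⟨N₃, h₃⟩ := hg.bounded
  obtain ⟨N₄, h₄⟩ := hh.bounded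
  -- All four terms of the homotopy take values in this ℝ^N', so a stage is mapped into a single
  -- stage.
  let N' := max (max N₁ N₂) (max N₃ N₄)
  let _ := stageTopology J S N'
  let Θ : Stage S N × unitInterval → X → EuclideanSpace ℝ (Fin N') := fun z p =>
    projRInf N' ((Φ ⟨inclRInf N ∘ z.1.1, z.1.2⟩ z.2).1 p)
  have hΘ : ∀ z, inclRInf N' ∘ Θ z = (Φ ⟨inclRInf N ∘ z.1.1, z.1.2⟩ z.2).1 := by
    intro z
    ext1 p
    refine inclRInf_projRInf fun i hi => ?_
    have hi' : max (max N₁ N₂) (max N₃ N₄) ≤ i := hi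
    simp only [max_le_iff] at hi'
    rw [hΦ]
    simp only [Function.comp_apply, Finsupp.add_apply, Finsupp.smul_apply]
    rw [h₁ _ (fun j hj => inclRInf_of_le hj _) i hi'.1.1,
      h₂ _ (fun j hj => inclRInf_of_le hj _) i hi'.1.2, h₃ p i hi'.2.1, h₄ p i hi'.2.2]
    simp
  let σ : Stage S N × unitInterval → Stage S N' := fun z =>
    ⟨Θ z, by rw [hΘ]; exact Subtype.property _⟩
  have hσ : Continuous σ := by
    refine continuous_induced_rng.2 ?_
    refine ((isSmoothFamily_iff (J := J) (u := Θ)).1 ?_).2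
    have hbase : IsSmoothFamily J fun z : Stage S N × unitInterval => z.1.1 := by
      refine isSmoothFamily_iff.2 ⟨fun z => ?_, ?_⟩
      · have := (hS _ z.1.2).contMDiff_projRInf N
        simpa using this
      · exact @Continuous.comp _ _ _ _ _ (smoothTopology J X _) _ _
          continuous_induced_dom continuous_fst
    let PA := (projRInf N' ∘ₗ A ∘ₗ inclLinear N).toContinuousLinearMap
    let PB := (projRInf N' ∘ₗ B ∘ₗ inclLinear N).toContinuousLinearMap
    have hs : Continuous fun z : Stage S N × unitInterval => ((z.2 : unitInterval) : ℝ) :=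
      continuous_subtype_val.comp continuous_snd
    have := (((hbase.clm_comp PA).add (.const (hg.contMDiff_projRInf N'))).smul
      ((continuous_const (y := (1 : ℝ))).sub hs)).add
      (((hbase.clm_comp PB).add (.const (hh.contMDiff_projRInf N'))).smul hs)
    refine (congrArg (IsSmoothFamily J) ?_).mp this
    funext z p
    simp [Θ, hΦ, PA, PB]
  have hι : Continuous fun f : Stage S N' => (⟨inclRInf N' ∘ f.1, f.2⟩ : S) :=
    continuous_iSup_rng (i := N') continuous_coinduced_rng
  exact (hι.comp hσ).congr fun z => Subtype.ext (hΘ z)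

end DirectLimit

/-! ### Rules for directional derivatives of real functions. -/

section DirDeriv

variable {E : Type*} [NormedAddCommGroup E] [NormedSpace ℝ E]
  {H : Type*} [TopologicalSpace H] {J : ModelWithCorners ℝ E H}
  {X : Type*} [TopologicalSpace X] [ChartedSpace H X]

lemma _root_.MDifferentiableAt.differentiableWithinAt_comp_symm {f : X → ℝ} {p : X}
    (hf : MDifferentiableAt J 𝓘(ℝ, ℝ) f p) :
    DifferentiableWithinAt ℝ (f ∘ (extChartAt J p).symm) (range J) (extChartAt J p p) :=
  hf.differentiableWithinAt_writtenInExtChartAt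

lemma dirDeriv_zero (f : X → ℝ) (p : X) : dirDeriv J f p 0 = 0 :=
  (mfderiv J 𝓘(ℝ, ℝ) f p).map_zero

lemma dirDeriv_add {f g : X → ℝ} {p : X} (hf : MDifferentiableAt J 𝓘(ℝ, ℝ) f p)
    (hg : MDifferentiableAt J 𝓘(ℝ, ℝ) g p) (u : E) :
    dirDeriv J (fun q => f q + g q) p u = dirDeriv J f p u + dirDeriv J g p u := by
  have hr := extChartAt_target_subset_range p (mem_extChartAt_target (I := J) p)
  have h : MDifferentiableAt J 𝓘(ℝ, ℝ) (fun q => f q + g q) p := hf.add hg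
  rw [hf.dirDeriv_eq_fderivWithin, hg.dirDeriv_eq_fderivWithin, h.dirDeriv_eq_fderivWithin]
  exact congrArg (fun L => L u) (fderivWithin_add (J.uniqueDiffOn _ hr)
    hf.differentiableWithinAt_comp_symm hg.differentiableWithinAt_comp_symm)

lemma dirDeriv_mul {f g : X → ℝ} {p : X} (hf : MDifferentiableAt J 𝓘(ℝ, ℝ) f p)
    (hg : MDifferentiableAt J 𝓘(ℝ, ℝ) g p) (u : E) :
    dirDeriv J (fun q => f q * g q) p u = f p * dirDeriv J g p u + g p * dirDeriv J f p u := by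
  have hr := extChartAt_target_subset_range p (mem_extChartAt_target (I := J) p)
  have h : MDifferentiableAt J 𝓘(ℝ, ℝ) (fun q => f q * g q) p := hf.mul hg
  rw [hf.dirDeriv_eq_fderivWithin, hg.dirDeriv_eq_fderivWithin, h.dirDeriv_eq_fderivWithin]
  have := congrArg (fun L => L u) (fderivWithin_mul (J.uniqueDiffOn _ hr)
    hf.differentiableWithinAt_comp_symm hg.differentiableWithinAt_comp_symm)
  simp only [_root_.add_apply, _root_.smul_apply, smul_eq_mul,
    Function.comp_apply, extChartAt_to_inv] at this
  exact this

lemma dirDeriv_const_mul (c : ℝ) {f : X → ℝ} {p : X} (hf : MDifferentiableAt J 𝓘(ℝ, ℝ) f p)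
    (u : E) : dirDeriv J (fun q => c * f q) p u = c * dirDeriv J f p u := by
  rw [dirDeriv_mul mdifferentiableAt_const hf, dirDeriv_const]
  simp

lemma dirDeriv_lineComb (a c : ℝ) {f g : X → ℝ} {p : X} (hf : MDifferentiableAt J 𝓘(ℝ, ℝ) f p)
    (hg : MDifferentiableAt J 𝓘(ℝ, ℝ) g p) (u : E) :
    dirDeriv J (fun q => a * f q + c * g q) p u = a * dirDeriv J f p u + c * dirDeriv J g p u := by
  have h1 : MDifferentiableAt J 𝓘(ℝ, ℝ) (fun q => a * f q) p := mdifferentiableAt_const.mul hf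
  have h2 : MDifferentiableAt J 𝓘(ℝ, ℝ) (fun q => c * g q) p := mdifferentiableAt_const.mul hg
  rw [dirDeriv_add h1 h2, dirDeriv_const_mul a hf, dirDeriv_const_mul c hg]

lemma dirDeriv_comp_deriv {f : X → ℝ} {h : ℝ → ℝ} {p : X} {h' : ℝ} (hh : HasDerivAt h h' (f p))
    (hf : MDifferentiableAt J 𝓘(ℝ, ℝ) f p) (u : E) :
    dirDeriv J (fun q => h (f q)) p u = h' * dirDeriv J f p u := by
  rw [dirDeriv_comp hh.differentiableAt hf, hh.hasFDerivAt.fderiv]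
  simp [mul_comm]

end DirDeriv

/-! ### Tangent vectors of the cylinder and the product-like top. -/

section Cylinder

variable {E : Type*} [NormedAddCommGroup E] [NormedSpace ℝ E]
  {H : Type*} [TopologicalSpace H] {I : ModelWithCorners ℝ E H}
  {M : Type*} [TopologicalSpace M] [ChartedSpace H M]

lemma contMDiff_height :
    ContMDiff (I.prod (𝓡∂ 1)) 𝓘(ℝ, ℝ) ∞ fun q : M × unitInterval => (q.2 : ℝ) :=
  (contMDiff_subtypeVal_Icc (x := 0) (y := 1)).comp contMDiff_snd

lemma mdifferentiableAt_height (p : M × unitInterval) :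
    MDifferentiableAt (I.prod (𝓡∂ 1)) 𝓘(ℝ, ℝ) (fun q : M × unitInterval => (q.2 : ℝ)) p :=
  contMDiff_height.mdifferentiableAt (by simp)

lemma mdifferentiableAt_fst {f : M → ℝ} {p : M × unitInterval}
    (hf : MDifferentiableAt I 𝓘(ℝ, ℝ) f p.1) :
    MDifferentiableAt (I.prod (𝓡∂ 1)) 𝓘(ℝ, ℝ) (fun q : M × unitInterval => f q.1) p :=
  hf.comp p _root_.mdifferentiableAt_fst

lemma dirDeriv_fst {f : M → ℝ} {p : M × unitInterval} (hf : MDifferentiableAt I 𝓘(ℝ, ℝ) f p.1)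
    (u : E × EuclideanSpace ℝ (Fin 1)) :
    dirDeriv (I.prod (𝓡∂ 1)) (fun q : M × unitInterval => f q.1) p u = dirDeriv I f p.1 u.1 := by
  have h := mfderiv_comp p hf (_root_.mdifferentiableAt_fst (I := I) (I' := 𝓡∂ 1) (x := p))
  unfold dirDeriv
  rw [show (fun q : M × unitInterval => f q.1) = f ∘ Prod.fst from rfl, h, mfderiv_fst]
  rfl

lemma dirDeriv_height_eq (p : M × unitInterval) (u : E × EuclideanSpace ℝ (Fin 1)) :
    dirDeriv (I.prod (𝓡∂ 1)) (fun q : M × unitInterval => (q.2 : ℝ)) p u =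
      dirDeriv (𝓡∂ 1) (fun t : unitInterval => (t : ℝ)) p.2 u.2 := by
  have hc : MDifferentiableAt (𝓡∂ 1) 𝓘(ℝ, ℝ) (fun t : unitInterval => (t : ℝ)) p.2 :=
    (contMDiff_subtypeVal_Icc (x := 0) (y := 1) (n := ∞)).mdifferentiableAt (by simp)
  have h := mfderiv_comp p hc (_root_.mdifferentiableAt_snd (I := I) (I' := 𝓡∂ 1) (x := p))
  unfold dirDeriv
  rw [show (fun q : M × unitInterval => (q.2 : ℝ)) = (fun t : unitInterval => (t : ℝ)) ∘ Prod.snd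
    from rfl, h, mfderiv_snd]
  rfl

/-- A tangent vector of the interval at `t` that is mapped to `1` by the inclusion into `ℝ`. -/
lemma exists_dirDeriv_height_eq_one (x : M) (t : unitInterval) :
    ∃ w : EuclideanSpace ℝ (Fin 1), ∀ a : E,
      dirDeriv (I.prod (𝓡∂ 1)) (fun q : M × unitInterval => (q.2 : ℝ)) (x, t) (a, w) = 1 := by
  refine ⟨(1 : TangentSpace (𝓡∂ 1) t), fun a => ?_⟩
  rw [dirDeriv_height_eq]
  exact mfderiv_subtypeVal_Icc_one (x := 0) (y := 1) t

/-- The tangent space of the interval is a line, spanned by a vector on which the height has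
derivative `1`. -/
lemma snd_eq_zero_of_dirDeriv_height {p : M × unitInterval} {u : E × EuclideanSpace ℝ (Fin 1)}
    (h : dirDeriv (I.prod (𝓡∂ 1)) (fun q : M × unitInterval => (q.2 : ℝ)) p u = 0) : u.2 = 0 := by
  obtain ⟨w, hw⟩ := exists_dirDeriv_height_eq_one (I := I) p.1 p.2
  have hw := hw u.1
  rw [dirDeriv_height_eq] at h hw
  simp only at hw
  have hw0 : w ≠ 0 := by
    rintro rfl
    rw [dirDeriv_zero] at hw
    exact zero_ne_one hw
  obtain ⟨c, hc⟩ := exists_smul_eq_of_finrank_eq_one (K := ℝ) (by simp) hw0 u.2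
  have hs : dirDeriv (𝓡∂ 1) (fun t : unitInterval => (t : ℝ)) p.2 (c • w) =
      c * dirDeriv (𝓡∂ 1) (fun t : unitInterval => (t : ℝ)) p.2 w :=
    (mfderiv (𝓡∂ 1) 𝓘(ℝ, ℝ) (fun t : unitInterval => (t : ℝ)) p.2).map_smul c w
  rw [hc, h, hw, mul_one] at hs
  rw [← hc, ← hs, zero_smul]

/-- The map `(x, t) ↦ φ(x, 1) + (t - 1) v`. -/
def topLine (v : RInf) (φ : M × unitInterval → RInf) (q : M × unitInterval) : RInf :=
  φ (q.1, 1) + ((q.2 : ℝ) - 1) • v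

lemma contMDiff_top {f : M × unitInterval → ℝ} (hf : ContMDiff (I.prod (𝓡∂ 1)) 𝓘(ℝ, ℝ) ∞ f) :
    ContMDiff I 𝓘(ℝ, ℝ) ∞ fun x => f (x, 1) :=
  hf.comp (contMDiff_id.prodMk contMDiff_const)

lemma IsSmoothRInf.topLine {φ : M × unitInterval → RInf} (h : IsSmoothRInf (I.prod (𝓡∂ 1)) φ)
    (v : RInf) : IsSmoothRInf (I.prod (𝓡∂ 1)) (topLine v φ) := by
  obtain ⟨N, hN⟩ := h.bounded
  obtain ⟨N', hN'⟩ := exists_forall_le_apply_eq_zero v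
  refine ⟨⟨max N N', fun p i hi => ?_⟩, fun i => ?_⟩
  · simp [ConcordanceEmb.topLine, hN _ i (le_trans (le_max_left _ _) hi),
      hN' i (le_trans (le_max_right _ _) hi)]
  · have h1 : ContMDiff (I.prod (𝓡∂ 1)) 𝓘(ℝ, ℝ) ∞ fun q : M × unitInterval => φ (q.1, 1) i :=
      (contMDiff_top (h.smooth i)).comp contMDiff_fst
    exact h1.add ((contMDiff_height.sub contMDiff_const).mul contMDiff_const)

lemma dirDeriv_topLine {φ : M × unitInterval → RInf} (h : IsSmoothRInf (I.prod (𝓡∂ 1)) φ)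
    (v : RInf) (x : M) (u : E × EuclideanSpace ℝ (Fin 1)) (i : ℕ) :
    dirDeriv (I.prod (𝓡∂ 1)) (fun q => topLine v φ q i) (x, 1) u =
      dirDeriv I (fun y => φ (y, 1) i) x u.1 +
        dirDeriv (I.prod (𝓡∂ 1)) (fun q : M × unitInterval => (q.2 : ℝ)) (x, 1) u * v i := by
  have h1 : MDifferentiableAt I 𝓘(ℝ, ℝ) (fun y => φ (y, 1) i) x :=
    (contMDiff_top (h.smooth i)).mdifferentiableAt (by simp)
  have h2 : (fun q : M × unitInterval => topLine v φ q i) =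
      fun q => φ (q.1, 1) i + (v i * (q.2 : ℝ) + - v i) := by
    ext q
    simp [topLine]
    ring
  have h3 : MDifferentiableAt (I.prod (𝓡∂ 1)) 𝓘(ℝ, ℝ)
      (fun q : M × unitInterval => v i * (q.2 : ℝ)) (x, 1) :=
    mdifferentiableAt_const.mul (mdifferentiableAt_height _)
  have h4 : MDifferentiableAt (I.prod (𝓡∂ 1)) 𝓘(ℝ, ℝ)
      (fun q : M × unitInterval => v i * (q.2 : ℝ) + - v i) (x, 1) := h3.add mdifferentiableAt_const
  rw [h2, dirDeriv_add (mdifferentiableAt_fst h1) h4,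
    dirDeriv_add h3 mdifferentiableAt_const,
    dirDeriv_fst (f := fun y => φ (y, 1) i) (p := (x, 1)) h1,
    dirDeriv_const_mul _ (mdifferentiableAt_height _), dirDeriv_const]
  ring

/-- An embedding that is product-like at the top has a direction at the top that is not tangent. -/
lemma productLikeTop_iff [CompactSpace M] [IsManifold I ∞ M] {φ : M × unitInterval → RInf}
    (h : IsSmoothEmbRInf (I.prod (𝓡∂ 1)) φ) :
    ProductLikeTop I φ ↔
      ∃ v, ∀ x : M, SameJetRInf (I.prod (𝓡∂ 1)) φ (topLine v φ) (x, 1) := by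
  constructor
  · rintro ⟨v, -, hv⟩
    exact ⟨v, hv⟩
  · rintro ⟨v, hv⟩
    refine ⟨v, fun x (a : E) ha => ?_, hv⟩
    obtain ⟨hs, -, hd⟩ := isSmoothEmbRInf_iff.1 h
    obtain ⟨w, hw⟩ := exists_dirDeriv_height_eq_one (I := I) x 1
    -- If `v` were the image of `a`, then `(-a, w)`, with `w` the upward unit vector, would be
    -- killed by the differential of `topLine v φ`, hence by that of `φ`, which is injective.
    have h0 : ((-a, w) : E × EuclideanSpace ℝ (Fin 1)) = 0 := by
      refine hd (x, 1) (-a, w) fun i => ?_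
      rw [(hv x i).dirDeriv_eq (hs.mdifferentiableAt i _) ((hs.topLine v).mdifferentiableAt i _),
        dirDeriv_topLine hs, hw]
      have hai : dirDeriv I (fun y => φ (y, 1) i) x a = v i := ha i
      have hai' : dirDeriv I (fun y => φ (y, 1) i) x (-a) =
          - dirDeriv I (fun y => φ (y, 1) i) x a :=
        (mfderiv I 𝓘(ℝ, ℝ) (fun y => φ (y, 1) i) x).map_neg a
      simp only
      rw [hai', hai]
      ring
    have := hw (-a)
    rw [h0, dirDeriv_zero] at this
    exact zero_ne_one this

end Cylinder

/-! ### Flat functions of one real variable. -/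

section FlatFunctions

/-- The convention `0⁻¹ = 0` makes the formula correct at `0` too, where the derivative vanishes. -/
lemma hasDerivAt_expNegInvGlue (x : ℝ) :
    HasDerivAt expNegInvGlue (x⁻¹ ^ 2 * expNegInvGlue x) x := by
  simpa using expNegInvGlue.hasDerivAt_polynomial_eval_inv_mul 1 x

lemma expNegInvGlue_injOn : InjOn expNegInvGlue (Ici 0) := by
  intro x hx y hy h
  rcases eq_or_lt_of_le (mem_Ici.1 hx) with rfl | hx
  · rw [expNegInvGlue.zero] at h
    exact le_antisymm hy (expNegInvGlue.zero_iff_nonpos.1 h.symm)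
  · have hy' : 0 < y := by
      by_contra hy'
      rw [expNegInvGlue.zero_of_nonpos (not_lt.1 hy')] at h
      exact (expNegInvGlue.pos_of_pos hx).ne' h
    simpa [expNegInvGlue, not_le.2 hx, not_le.2 hy'] using h

/-- A smooth function that is positive inside the unit interval, flat at its ends, and whose
value at `1` is prescribed to vanish or not. -/
lemma exists_flat_cutoff (b : Prop) : ∃ γ : ℝ → ℝ, ContDiff ℝ ∞ γ ∧ EqOn γ (fun _ => 0) (Iic 0) ∧
    EqOn γ (fun _ => γ 1) (Ici 1) ∧ (∀ t, 0 < t → t < 1 → γ t ≠ 0) ∧ (γ 1 = 0 ↔ b) := by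
  by_cases hb : b
  -- If the top is fixed, a bump flat at both ends is needed; otherwise a smooth step, equal to `1`
  -- at the top and with constant jet there.
  · refine ⟨fun t => expNegInvGlue t * expNegInvGlue (1 - t),
      expNegInvGlue.contDiff.mul (expNegInvGlue.contDiff.comp (contDiff_const.sub contDiff_id)),
      fun t ht => ?_, fun t ht => ?_, fun t h0 h1 => ?_, ?_⟩
    · simp [expNegInvGlue.zero_of_nonpos (mem_Iic.1 ht)]
    · simp [expNegInvGlue.zero_of_nonpos (sub_nonpos.2 (mem_Ici.1 ht))]
    · exact (mul_pos (expNegInvGlue.pos_of_pos h0)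
        (expNegInvGlue.pos_of_pos (sub_pos.2 h1))).ne'
    · simp [hb]
  · refine ⟨Real.smoothTransition, Real.smoothTransition.contDiff,
      fun t ht => Real.smoothTransition.zero_of_nonpos ht,
      fun t ht => ?_, fun t h0 _ => (Real.smoothTransition.pos_of_pos h0).ne', ?_⟩
    · simp [Real.smoothTransition.one_of_one_le (mem_Ici.1 ht)]
    · simp [hb]

end FlatFunctions

/-! ### Construction of the auxiliary coordinates. -/

section Auxiliary

variable {E : Type*} [NormedAddCommGroup E] [NormedSpace ℝ E]
  {H : Type*} [TopologicalSpace H] (I : ModelWithCorners ℝ E H)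
  {M : Type*} [TopologicalSpace M] [ChartedSpace H M] {d : ℕ}

/-- The part of `M × [0,1]` along which jets are prescribed; the proposition `b` says whether the
top `M × {1}` is part of it. -/
def fixedLocus (b : Prop) : Set (M × unitInterval) :=
  {p | p.2 = 0 ∨ p.1 ∈ I.boundary M ∨ (b ∧ p.2 = 1)}

variable {I}

/-- Used with the half-lines `Iic 0` and `Ici 1`, which meet the interval only in an endpoint:
agreement beyond that end already determines all derivatives there. -/
lemma sameJet_height [IsManifold I ∞ M] {h₁ h₂ : ℝ → ℝ} (hh₁ : ContDiff ℝ ∞ h₁)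
    (hh₂ : ContDiff ℝ ∞ h₂) {s : Set ℝ} (hs : UniqueDiffOn ℝ s) (h : EqOn h₁ h₂ s)
    {p : M × unitInterval} (hp : (p.2 : ℝ) ∈ s) :
    SameJet (I.prod (𝓡∂ 1)) (fun q => h₁ (q.2 : ℝ)) (fun q => h₂ (q.2 : ℝ)) p :=
  SameJet.comp contMDiff_height contMDiff_height hh₁ hh₂ (.refl _ _)
    fun k => iteratedFDeriv_eq_of_eqOn hh₁ hh₂ hs h hp k

lemma dirDeriv_comp_height {h : ℝ → ℝ} {h' : ℝ} {p : M × unitInterval}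
    (hh : HasDerivAt h h' (p.2 : ℝ)) (u : E × EuclideanSpace ℝ (Fin 1)) :
    dirDeriv (I.prod (𝓡∂ 1)) (fun q : M × unitInterval => h (q.2 : ℝ)) p u =
      h' * dirDeriv (I.prod (𝓡∂ 1)) (fun q : M × unitInterval => (q.2 : ℝ)) p u :=
  dirDeriv_comp_deriv (f := fun q : M × unitInterval => (q.2 : ℝ)) hh
    (mdifferentiableAt_height p) u

lemma SameJet.mul_right_of_zero [IsManifold I ∞ M] {f g : M × unitInterval → ℝ}
    (hf : ContMDiff (I.prod (𝓡∂ 1)) 𝓘(ℝ, ℝ) ∞ f) (hg : ContMDiff (I.prod (𝓡∂ 1)) 𝓘(ℝ, ℝ) ∞ g)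
    {p : M × unitInterval} (h : SameJet (I.prod (𝓡∂ 1)) f (fun _ => 0) p) :
    SameJet (I.prod (𝓡∂ 1)) (fun q => f q * g q) (fun _ => 0) p := by
  simpa using SameJet.mul hf contMDiff_const hg hg h (.refl g p)

/-- Auxiliary coordinates on `M × [0,1]`: they are flat along the fixed locus, product-like at the
top, and separate points and (up to a vertical direction at the top) tangent vectors off the fixed
locus. -/
lemma exists_auxiliary_coordinates [FiniteDimensional ℝ E] [T2Space M] [CompactSpace M]
    [IsManifold I ∞ M] {e : M → EuclideanSpace ℝ (Fin d)} (he : IsSmoothEmb I e) (b : Prop) :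
    ∃ (K : ℕ) (g : ℕ → M × unitInterval → ℝ) (w : ℕ → ℝ),
      (∀ j, K ≤ j → g j = fun _ => 0) ∧ (∀ j, K ≤ j → w j = 0) ∧
      (∀ j, ContMDiff (I.prod (𝓡∂ 1)) 𝓘(ℝ, ℝ) ∞ (g j)) ∧
      (∀ j, ∀ p ∈ fixedLocus I b, SameJet (I.prod (𝓡∂ 1)) (g j) (fun _ => 0) p) ∧
      (∀ j x, SameJet (I.prod (𝓡∂ 1)) (g j)
        (fun q => g j (q.1, 1) + ((q.2 : ℝ) - 1) * w j) (x, 1)) ∧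
      (∀ p q, p ∉ fixedLocus I b → (∀ j, g j p = g j q) → p = q) ∧
      (∀ p, p ∉ fixedLocus I b → ∀ u : E × EuclideanSpace ℝ (Fin 1),
        (∀ j, dirDeriv (I.prod (𝓡∂ 1)) (g j) p u = 0) →
          u.1 = 0 ∧ (u.2 = 0 ∨ p.2 = 1 ∧ ∃ x₀ : M, (x₀, 1) ∈ fixedLocus I b)) := by
  classical
  obtain ⟨γ, hγ, hγ0, hγ1, hγpos, hγb⟩ := exists_flat_cutoff b
  -- The boundary is closed, so it is the exact zero set of a smooth nonnegative function; composing
  -- with `expNegInvGlue` makes it flat there.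
  obtain ⟨f, hfs, hf, hf0⟩ := (I.isClosed_boundary (M := M) (n := ∞)
    (by simp)).isOpen_compl.exists_contMDiff_support_eq (n := ⊤) I
  have hfb : ∀ x, f x = 0 ↔ x ∈ I.boundary M := fun x => by
    have : x ∈ f.support ↔ x ∈ (I.boundary M)ᶜ := by rw [hfs]
    simpa [not_iff_not] using this
  -- The coordinate `ε * θ` has vertical derivative `ε` along the whole top, so it must be switched
  -- off as soon as one point of the top is fixed.
  obtain ⟨ε, hε0, hε1⟩ : ∃ ε : ℝ, ((∃ x₀ : M, (x₀, 1) ∈ fixedLocus I b) → ε = 0) ∧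
      (ε = 0 → ∃ x₀ : M, (x₀, 1) ∈ fixedLocus I b) := by
    by_cases h : ∃ x₀ : M, (x₀, (1 : unitInterval)) ∈ fixedLocus I b
    · exact ⟨0, fun _ => rfl, fun _ => h⟩
    · exact ⟨1, fun h' => (h h').elim, fun h' => (one_ne_zero h').elim⟩
  have hG : ContDiff ℝ ∞ expNegInvGlue := expNegInvGlue.contDiff
  -- `η` separates heights but is flat at the top, so it does not disturb the product-like form; `θ`
  -- below is flat at the bottom and agrees with the height to all orders at the top.
  let η : ℝ → ℝ := fun t => expNegInvGlue (1 - t)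
  have hη : ContDiff ℝ ∞ η := hG.comp (contDiff_const.sub contDiff_id)
  let θ : ℝ → ℝ := fun t => t * Real.smoothTransition t
  have hθ : ContDiff ℝ ∞ θ := contDiff_id.mul Real.smoothTransition.contDiff
  have hη1 : EqOn η (fun _ => 0) (Ici 1) := fun t ht =>
    expNegInvGlue.zero_of_nonpos (sub_nonpos.2 (mem_Ici.1 ht))
  have hθ0 : EqOn θ (fun _ => 0) (Iic 0) := fun t ht => by
    simp [θ, Real.smoothTransition.zero_of_nonpos (mem_Iic.1 ht)]
  have hθ1 : EqOn θ id (Ici 1) := fun t ht => by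
    simp [θ, Real.smoothTransition.one_of_one_le (mem_Ici.1 ht)]
  have u0 : UniqueDiffOn ℝ (Iic (0 : ℝ)) := uniqueDiffOn_Iic 0
  have u1 : UniqueDiffOn ℝ (Ici (1 : ℝ)) := uniqueDiffOn_Ici 1
  let r : M × unitInterval → ℝ := fun q => expNegInvGlue (f q.1)
  have hfX : ContMDiff (I.prod (𝓡∂ 1)) 𝓘(ℝ, ℝ) ∞ fun q : M × unitInterval => f q.1 :=
    hf.comp contMDiff_fst
  have hr : ContMDiff (I.prod (𝓡∂ 1)) 𝓘(ℝ, ℝ) ∞ r := hG.contMDiff.comp hfX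
  have hheight {h : ℝ → ℝ} (hh : ContDiff ℝ ∞ h) : ContMDiff (I.prod (𝓡∂ 1)) 𝓘(ℝ, ℝ) ∞
      fun q : M × unitInterval => h (q.2 : ℝ) := hh.contMDiff.comp contMDiff_height
  let ρ : M × unitInterval → ℝ := fun q => r q * γ q.2
  have hρ : ContMDiff (I.prod (𝓡∂ 1)) 𝓘(ℝ, ℝ) ∞ ρ := hr.mul (hheight hγ)
  have heX (j : ℕ) : ContMDiff (I.prod (𝓡∂ 1)) 𝓘(ℝ, ℝ) ∞
      fun q : M × unitInterval => inclRInf d (e q.1) j :=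
    ((isSmoothRInf_inclRInf he.1).smooth j).comp contMDiff_fst
  have hρflat : ∀ p ∈ fixedLocus I b, SameJet (I.prod (𝓡∂ 1)) ρ (fun _ => 0) p := by
    rintro p (hp | hp | ⟨hb, hp⟩)
    · have h := sameJet_height (I := I) (M := M) hγ contDiff_const u0 hγ0 (p := p) (by simp [hp])
      simpa [ρ, mul_comm] using h.mul_right_of_zero (hheight hγ) hr
    · refine SameJet.mul_right_of_zero hr (hheight hγ) ?_
      exact SameJet.comp hfX hfX hG contDiff_const (.refl _ _) fun k =>
        iteratedFDeriv_eq_of_eqOn hG contDiff_const u0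
          (fun t ht => expNegInvGlue.zero_of_nonpos ht) (by simp [(hfb p.1).2 hp]) k
    · have h := sameJet_height (I := I) (M := M) hγ contDiff_const u1 hγ1 (p := p) (by simp [hp])
      rw [hγb.2 hb] at h
      simpa [ρ, mul_comm] using h.mul_right_of_zero (hheight hγ) hr
  have hρne : ∀ p, p ∉ fixedLocus I b → ρ p ≠ 0 := by
    intro p hp
    simp only [fixedLocus, mem_ofPred_eq, not_or, not_and] at hp
    obtain ⟨h0, hbd, h1⟩ := hp
    have hfp : 0 < f p.1 := lt_of_le_of_ne (hf0 _) (Ne.symm (mt (hfb _).1 hbd))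
    refine mul_ne_zero (expNegInvGlue.pos_of_pos hfp).ne' ?_
    by_cases ht : p.2 = 1
    · have : ¬ b := fun hb => h1 hb ht
      rw [ht]
      exact mt hγb.1 this
    · exact hγpos _ (unitInterval.pos_iff_ne_zero.2 h0) (unitInterval.lt_one_iff_ne_one.2 ht)
  -- The factor `1` makes `ρ` itself a coordinate. Off the fixed locus one can then divide by `ρ`
  -- and recover `η` and the coordinates of `e`.
  let c : ℕ → M × unitInterval → ℝ := fun
    | 0 => fun _ => 1
    | 1 => fun q => η q.2
    | j + 2 => fun q => inclRInf d (e q.1) j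
  have hc : ∀ j, ContMDiff (I.prod (𝓡∂ 1)) 𝓘(ℝ, ℝ) ∞ (c j) := fun
    | 0 => contMDiff_const
    | 1 => hheight hη
    | j + 2 => heX j
  have hctop : ∀ j x, SameJet (I.prod (𝓡∂ 1)) (c j) (fun q => c j (q.1, 1)) (x, 1) := fun
    | 0, x => .refl _ _
    | 1, x => by
      have h := sameJet_height (I := I) hη contDiff_const u1 hη1 (p := (x, 1)) (by simp)
      simpa [c, η] using h
    | j + 2, x => .refl _ _
  let g : ℕ → M × unitInterval → ℝ := fun
    | 0 => fun q => ε * θ q.2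
    | j + 1 => fun q => ρ q * c j q
  have hg : ∀ j, ContMDiff (I.prod (𝓡∂ 1)) 𝓘(ℝ, ℝ) ∞ (g j) := fun
    | 0 => contMDiff_const.mul (hheight hθ)
    | j + 1 => hρ.mul (hc j)
  -- The coordinates are `ε * θ`, `ρ`, `ρ * η` and `ρ` times the `d` coordinates of `e`. All but the
  -- first have jets constant in the height at the top, hence direction `0`.
  refine ⟨d + 3, g, fun j => if j = 0 then ε else 0, ?_, ?_, hg, ?_, ?_, ?_, ?_⟩
  · intro j hj
    obtain ⟨j, rfl⟩ : ∃ k, j = k + 3 := ⟨j - 3, by omega⟩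
    funext q
    simp [g, c, inclRInf_of_le (show d ≤ j by omega)]
  · intro j hj
    exact if_neg (by omega)
  · rintro (_ | j) p hp
    · rcases hp with hp | hp
      · have h := sameJet_height (I := I) (M := M) hθ contDiff_const u0 hθ0 (p := p) (by simp [hp])
        simpa [g, mul_comm] using h.mul_right_of_zero (hheight hθ) (contMDiff_const (c := ε))
      · have : ε = 0 := by
          refine hε0 ⟨p.1, ?_⟩
          rcases hp with hp | hp
          · exact Or.inr (Or.inl hp)
          · exact Or.inr (Or.inr ⟨hp.1, rfl⟩)
        simp only [g, this, zero_mul]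
        exact .refl _ _
    · exact (hρflat p hp).mul_right_of_zero hρ (hc j)
  · rintro (_ | j) x
    · have h := sameJet_height (I := I) hθ contDiff_id u1 hθ1 (p := (x, 1)) (by simp)
      have h' := h.const_smul ε (hheight hθ) (hheight contDiff_id)
      refine h'.trans ?_
      have e : (fun q : M × unitInterval => g 0 (q.1, 1) + ((q.2 : ℝ) - 1) *
          if 0 = 0 then ε else 0) = fun q => ε • id (q.2 : ℝ) := by
        funext q
        simp [g, θ]
        ring
      rw [e]
      exact .refl _ _
    · have h := sameJet_height (I := I) hγ contDiff_const u1 hγ1 (p := (x, 1)) (by simp)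
      have h' := (SameJet.refl r (x, 1)).mul hr hr (hheight hγ) contMDiff_const h
      have h'' := h'.mul hρ (hr.mul contMDiff_const) (hc j)
        ((contMDiff_top (hc j)).comp contMDiff_fst) (hctop j x)
      simpa [g, ρ, r] using h''
  · intro p q hp h
    have hρp := hρne p hp
    have h0 : ρ p = ρ q := by simpa [g, c] using h 1
    have hcpq : ∀ j, c j p = c j q := fun j => by
      have := h (j + 1)
      simp only [g, ← h0] at this
      exact mul_left_cancel₀ hρp this
    refine Prod.ext ?_ ?_
    · refine he.2.2.injective ?_
      ext i
      simpa [c] using hcpq (i + 2)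
    · have h1 := hcpq 1
      have := expNegInvGlue_injOn (sub_nonneg.2 p.2.2.2 : (0 : ℝ) ≤ 1 - (p.2 : ℝ))
        (sub_nonneg.2 q.2.2.2 : (0 : ℝ) ≤ 1 - (q.2 : ℝ)) h1
      exact Subtype.ext (by linarith)
  · intro p hp u hu
    have hρp := hρne p hp
    have md {k : M × unitInterval → ℝ} (hk : ContMDiff (I.prod (𝓡∂ 1)) 𝓘(ℝ, ℝ) ∞ k) :
        MDifferentiableAt (I.prod (𝓡∂ 1)) 𝓘(ℝ, ℝ) k p := hk.mdifferentiableAt (by simp)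
    have hDρ : dirDeriv (I.prod (𝓡∂ 1)) ρ p u = 0 := by simpa [g, c] using hu 1
    -- Infinitesimal division by `ρ`: since its derivative vanishes and its value does not, Leibniz'
    -- rule leaves only the derivative of `c j`.
    have hDc : ∀ j, dirDeriv (I.prod (𝓡∂ 1)) (c j) p u = 0 := fun j => by
      have := hu (j + 1)
      simp only [g] at this
      rw [dirDeriv_mul (md hρ) (md (hc j)), hDρ, mul_zero, add_zero] at this
      exact (mul_eq_zero.1 this).resolve_left hρp
    have hu1 : u.1 = 0 := by
      have hemb : ∀ i, dirDeriv I (fun y => inclRInf d (e y) i) p.1 u.1 = 0 := fun i => by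
        have h1 : MDifferentiableAt I 𝓘(ℝ, ℝ) (fun y => inclRInf d (e y) i) p.1 :=
          (isSmoothRInf_inclRInf he.1).mdifferentiableAt i p.1
        rw [← dirDeriv_fst h1]
        exact hDc (i + 2)
      exact (isSmoothEmbRInf_iff.1 ⟨d, e, he, rfl⟩ :
        IsSmoothRInf I (inclRInf d ∘ e) ∧ _).2.2 p.1 u.1 hemb
    refine ⟨hu1, ?_⟩
    -- Below the top `η` has nonzero derivative. At the top it is flat, and only `ε * θ` can detect
    -- the vertical direction.
    by_cases ht : p.2 = 1
    · by_cases hε : ε = 0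
      · exact Or.inr ⟨ht, hε1 hε⟩
      · left
        have h0 := hu 0
        have hd : HasDerivAt (fun t : ℝ => ε * θ t) (ε * 1) (p.2 : ℝ) := by
          refine HasDerivAt.const_mul ε ?_
          -- The derivative of `θ` at `1` is read off from the right, where `θ` is the identity.
          have h1 : HasDerivAt θ (deriv θ (p.2 : ℝ)) (p.2 : ℝ) :=
            (hθ.differentiable (by simp)).differentiableAt.hasDerivAt
          have h2 := h1.hasDerivWithinAt (s := Ici 1)
          have hp1 : (p.2 : ℝ) ∈ Ici (1 : ℝ) := by simp [ht]
          have h3 := (hasDerivWithinAt_id (p.2 : ℝ) (Ici 1)).congr hθ1 (hθ1 hp1)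
          rwa [(u1 _ hp1).eq_deriv _ h2 h3] at h1
        rw [show g 0 = fun q : M × unitInterval => (fun t => ε * θ t) (q.2 : ℝ) from rfl,
          dirDeriv_comp_height hd] at h0
        refine snd_eq_zero_of_dirDeriv_height ((mul_eq_zero.1 h0).resolve_left ?_)
        simpa using hε
    · left
      have h1 := hDc 1
      have hlt : 0 < 1 - (p.2 : ℝ) := sub_pos.2 (unitInterval.lt_one_iff_ne_one.2 ht)
      have hd : HasDerivAt η (((1 - (p.2 : ℝ))⁻¹ ^ 2 * expNegInvGlue (1 - (p.2 : ℝ))) * (-1))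
          (p.2 : ℝ) :=
        (hasDerivAt_expNegInvGlue (1 - (p.2 : ℝ))).comp (p.2 : ℝ)
          ((hasDerivAt_id (p.2 : ℝ)).const_sub 1)
      rw [show c 1 = fun q : M × unitInterval => η (q.2 : ℝ) from rfl,
        dirDeriv_comp_height hd] at h1
      refine snd_eq_zero_of_dirDeriv_height ((mul_eq_zero.1 h1).resolve_left ?_)
      have := expNegInvGlue.pos_of_pos hlt
      have h2 : 0 < (1 - (p.2 : ℝ))⁻¹ ^ 2 := by positivity
      exact mul_ne_zero (mul_pos h2 this).ne' (by norm_num)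

end Auxiliary

/-! ### Linear operations on maps to ℝ^∞ and straight line homotopies. -/

section General

variable {E : Type*} [NormedAddCommGroup E] [NormedSpace ℝ E]
  {H : Type*} [TopologicalSpace H] {J : ModelWithCorners ℝ E H}
  {X : Type*} [TopologicalSpace X] [ChartedSpace H X]

lemma IsSmoothRInf.add {φ ψ : X → RInf} (hφ : IsSmoothRInf J φ) (hψ : IsSmoothRInf J ψ) :
    IsSmoothRInf J fun q => φ q + ψ q := by
  obtain ⟨N, hN⟩ := hφ.bounded
  obtain ⟨N', hN'⟩ := hψ.bounded
  refine ⟨⟨max N N', fun p i hi => ?_⟩, fun i => (hφ.smooth i).add (hψ.smooth i)⟩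
  simp [hN p i (le_trans (le_max_left _ _) hi), hN' p i (le_trans (le_max_right _ _) hi)]

lemma IsSmoothRInf.const_smul {φ : X → RInf} (hφ : IsSmoothRInf J φ) (c : ℝ) :
    IsSmoothRInf J fun q => c • φ q := by
  obtain ⟨N, hN⟩ := hφ.bounded
  exact ⟨⟨N, fun p i hi => by simp [hN p i hi]⟩, fun i => contMDiff_const.mul (hφ.smooth i)⟩

lemma isSmoothRInf_zero : IsSmoothRInf J fun _ : X => (0 : RInf) :=
  ⟨⟨0, fun _ _ _ => rfl⟩, fun _ => contMDiff_const⟩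

lemma SameJetRInf.add [IsManifold J ∞ X] {φ φ' ψ ψ' : X → RInf} {p : X}
    (h₁ : IsSmoothRInf J φ) (h₂ : IsSmoothRInf J φ') (h₃ : IsSmoothRInf J ψ)
    (h₄ : IsSmoothRInf J ψ') (h : SameJetRInf J φ φ' p) (h' : SameJetRInf J ψ ψ' p) :
    SameJetRInf J (fun q => φ q + ψ q) (fun q => φ' q + ψ' q) p :=
  fun i => (h i).add (h₁.smooth i) (h₂.smooth i) (h₃.smooth i) (h₄.smooth i) (h' i)

lemma SameJetRInf.const_smul [IsManifold J ∞ X] {φ φ' : X → RInf} {p : X} (c : ℝ)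
    (h₁ : IsSmoothRInf J φ) (h₂ : IsSmoothRInf J φ') (h : SameJetRInf J φ φ' p) :
    SameJetRInf J (fun q => c • φ q) (fun q => c • φ' q) p :=
  fun i => (h i).const_smul c (h₁.smooth i) (h₂.smooth i)

lemma SameJetRInf.apply_eq {φ ψ : X → RInf} {p : X} (h : SameJetRInf J φ ψ p) : φ p = ψ p :=
  Finsupp.ext fun i => (h i).apply_eq

/-- The derivatives of the coordinates of a map to `ℝ^∞` form a vector in `ℝ^∞`. -/
lemma IsSmoothRInf.exists_dirDeriv {φ : X → RInf} (hφ : IsSmoothRInf J φ) (p : X) (u : E) :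
    ∃ w : RInf, ∀ i, w i = dirDeriv J (fun q => φ q i) p u := by
  obtain ⟨N, hN⟩ := hφ.bounded
  refine ⟨Finsupp.onFinset (Finset.range N) (fun i => dirDeriv J (fun q => φ q i) p u)
    fun i hi => ?_, fun i => rfl⟩
  by_contra h
  have : (fun q => φ q i) = fun _ => (0 : ℝ) :=
    funext fun q => hN q i (not_lt.1 fun h' => h (Finset.mem_range.2 h'))
  rw [this, dirDeriv_const] at hi
  exact hi rfl

/-- A straight line homotopy, as in `continuous_line`, is a homotopy between its end maps. -/
lemma exists_homotopic_line [IsManifold J ∞ X] {S : Set (X → RInf)}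
    (hS : ∀ φ ∈ S, IsSmoothRInf J φ)
    (A B : RInf →ₗ[ℝ] RInf) {g h : X → RInf} (hg : IsSmoothRInf J g) (hh : IsSmoothRInf J h)
    (hmem : ∀ φ ∈ S, ∀ s : unitInterval,
      (fun p => (1 - (s : ℝ)) • (A (φ p) + g p) + (s : ℝ) • (B (φ p) + h p)) ∈ S) :
    letI := directLimitTopology J S
    ∃ f₀ f₁ : C(S, S), (∀ φ, (f₀ φ).1 = fun p => A (φ.1 p) + g p) ∧
      (∀ φ, (f₁ φ).1 = fun p => B (φ.1 p) + h p) ∧ f₀.Homotopic f₁ := by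
  let _ := directLimitTopology J S
  let Φ : S → unitInterval → S := fun φ s => ⟨_, hmem φ.1 φ.2 s⟩
  have hΦ : Continuous fun z : S × unitInterval => Φ z.1 z.2 :=
    continuous_line hS A B hg hh Φ fun _ _ _ => rfl
  have h0 : ∀ φ : S, (Φ φ 0).1 = fun p => A (φ.1 p) + g p := fun φ => by
    funext p
    simp [Φ]
  have h1 : ∀ φ : S, (Φ φ 1).1 = fun p => B (φ.1 p) + h p := fun φ => by
    funext p
    simp [Φ]
  clear_value Φ
  let f₀ : C(S, S) := ⟨fun φ => Φ φ 0, hΦ.comp (Continuous.prodMk_left 0)⟩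
  let f₁ : C(S, S) := ⟨fun φ => Φ φ 1, hΦ.comp (Continuous.prodMk_left 1)⟩
  let F : f₀.Homotopy f₁ :=
    { toFun := fun z => Φ z.2 z.1
      continuous_toFun := hΦ.comp continuous_swap
      map_zero_left := fun φ => rfl
      map_one_left := fun φ => rfl }
  exact ⟨f₀, f₁, h0, h1, ⟨F⟩⟩

end General

/-! ### The shift, which vacates `K` coordinates. -/

section Shift

/-- The endomorphism of `ℝ^∞` that fixes the first `d + 1` coordinates and moves the others up
by `K`. -/
def shift (d K : ℕ) : RInf →ₗ[ℝ] RInf :=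
  Finsupp.lmapDomain ℝ ℝ fun i => if i ≤ d then i else i + K

lemma shift_index_injective (d K : ℕ) :
    Function.Injective fun i : ℕ => if i ≤ d then i else i + K := by
  intro i j h
  simp only at h
  split_ifs at h <;> omega

lemma shift_apply_index (d K : ℕ) (x : RInf) (i : ℕ) :
    shift d K x (if i ≤ d then i else i + K) = x i :=
  Finsupp.mapDomain_apply (shift_index_injective d K) x i

lemma shift_apply (d K : ℕ) (x : RInf) (i : ℕ) :
    shift d K x i = if i ≤ d then x i else if i ≤ d + K then 0 else x (i - K) := by
  split_ifs with h h'
  · simpa [h] using shift_apply_index d K x i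
  · refine Finsupp.mapDomain_of_notMem_range _ _ ?_
    rintro ⟨j, hj⟩
    simp only at hj
    split_ifs at hj <;> omega
  · have := shift_apply_index d K x (i - K)
    rwa [if_neg (by omega), Nat.sub_add_cancel (by omega)] at this

/-- Consider the last nonzero coordinate of `x`. If the shift fixes its index, the combination there
is just `x i`; if it moves the index up, only the shifted term survives at the new index. So the
line from the identity to the shift consists of injective linear maps. -/
lemma shift_line_eq_zero {d K : ℕ} {s : ℝ} {x : RInf}
    (h : ∀ i, (1 - s) * x i + s * shift d K x i = 0) : x = 0 := by
  rcases eq_or_ne s 0 with rfl | hs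
  · ext i
    simpa using h i
  by_contra hx
  have hne : x.support.Nonempty := Finsupp.support_nonempty_iff.2 hx
  let i := x.support.max' hne
  have hi : x i ≠ 0 := Finsupp.mem_support_iff.1 (Finset.max'_mem _ hne)
  have hmax : ∀ j, i < j → x j = 0 := fun j hj => by
    by_contra hj'
    exact absurd (Finset.le_max' x.support j (Finsupp.mem_support_iff.2 hj')) (not_le.2 hj)
  have h1 := h (if i ≤ d then i else i + K)
  rw [shift_apply_index] at h1
  by_cases hσ : (if i ≤ d then i else i + K) = i
  · rw [hσ] at h1
    exact hi (by linarith)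
  · have : i < (if i ≤ d then i else i + K) := by
      split_ifs at hσ ⊢ <;> omega
    rw [hmax _ this, mul_zero, zero_add] at h1
    exact (mul_ne_zero hs hi) h1

lemma shift_coord {X : Type*} (d K : ℕ) (φ : X → RInf) (i : ℕ) :
    (fun q => shift d K (φ q) i) =
      if i ≤ d then fun q => φ q i else if i ≤ d + K then fun _ => 0 else fun q => φ q (i - K) := by
  funext q
  rw [shift_apply]
  split_ifs <;> rfl

variable {E : Type*} [NormedAddCommGroup E] [NormedSpace ℝ E]
  {H : Type*} [TopologicalSpace H] {J : ModelWithCorners ℝ E H}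
  {X : Type*} [TopologicalSpace X] [ChartedSpace H X]

lemma IsSmoothRInf.shift {φ : X → RInf} (hφ : IsSmoothRInf J φ) (d K : ℕ) :
    IsSmoothRInf J fun q => shift d K (φ q) := by
  obtain ⟨N, hN⟩ := hφ.bounded
  obtain ⟨N', hN'⟩ := exists_linear_bound (ConcordanceEmb.shift d K) N
  refine ⟨⟨N', fun p => hN' _ (hN p)⟩, fun i => ?_⟩
  rw [shift_coord]
  split_ifs
  exacts [hφ.smooth i, contMDiff_const, hφ.smooth _]

lemma SameJetRInf.shift {φ ψ : X → RInf} {p : X} (h : SameJetRInf J φ ψ p) (d K : ℕ) :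
    SameJetRInf J (fun q => shift d K (φ q)) (fun q => shift d K (ψ q)) p := by
  intro i
  rw [shift_coord, shift_coord]
  split_ifs
  exacts [h i, .refl _ _, h _]

lemma dirDeriv_shift {φ : X → RInf} {p : X} {u : E} {w : RInf}
    (hw : ∀ i, w i = dirDeriv J (fun q => φ q i) p u) (d K i : ℕ) :
    dirDeriv J (fun q => shift d K (φ q) i) p u = shift d K w i := by
  rw [shift_coord, shift_apply]
  split_ifs
  exacts [(hw i).symm, dirDeriv_const _ _ _, (hw _).symm]

end Shift

/-! ### The standard cylinder, and linearity of its top conditions. -/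

section StdCylinder

variable {M : Type*} {d : ℕ} {e : M → EuclideanSpace ℝ (Fin d)}

lemma stdCylinder_apply (q : M × unitInterval) (i : ℕ) :
    stdCylinder e q i = inclRInf d (e q.1) i + if d = i then (q.2 : ℝ) else 0 := by
  simp [stdCylinder, Finsupp.single_apply]

lemma stdCylinder_apply_self (q : M × unitInterval) : stdCylinder e q d = q.2 := by
  simp [stdCylinder_apply, inclRInf_of_le]

lemma stdCylinder_apply_of_lt {i : ℕ} (h : i < d) (q : M × unitInterval) :
    stdCylinder e q i = inclRInf d (e q.1) i := by
  simp [stdCylinder_apply, h.ne']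

lemma stdCylinder_apply_of_gt {i : ℕ} (h : d < i) (q : M × unitInterval) :
    stdCylinder e q i = 0 := by
  simp [stdCylinder_apply, h.ne, inclRInf_of_le h.le]

/-- The cylinder lives in the coordinates `0, …, d`, which the shift fixes; hence shifting preserves
the prescribed jets. -/
lemma shift_stdCylinder (K : ℕ) (q : M × unitInterval) :
    shift d K (stdCylinder e q) = stdCylinder e q := by
  ext i
  rw [shift_apply]
  split_ifs with h h'
  · rfl
  · rw [stdCylinder_apply_of_gt (not_le.1 h)]
  · rw [stdCylinder_apply_of_gt (not_le.1 h), stdCylinder_apply_of_gt (by omega)]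

lemma topLine_stdCylinder :
    topLine (Finsupp.single d 1) (stdCylinder e) = (stdCylinder e : M × unitInterval → RInf) := by
  funext q
  ext i
  simp only [topLine, Finsupp.add_apply, Finsupp.smul_apply, stdCylinder_apply,
    Finsupp.single_apply]
  split_ifs <;> simp

/-- Linearity in the pair of direction and map is what makes product-likeness survive straight
lines, with the direction moving along. -/
lemma topLine_lineComb (a c : ℝ) (v w : RInf) (φ ψ : M × unitInterval → RInf) :
    topLine (a • v + c • w) (fun q => a • φ q + c • ψ q) =
      fun q => a • topLine v φ q + c • topLine w ψ q := by
  funext q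
  ext i
  simp [topLine]
  ring

lemma topLine_shift (K : ℕ) (v : RInf) (φ : M × unitInterval → RInf) :
    topLine (shift d K v) (fun q => shift d K (φ q)) = fun q => shift d K (topLine v φ q) := by
  funext q
  simp [topLine]

end StdCylinder

/-! ### Admissible maps and the three-step contraction. -/

section Contraction

variable {E : Type*} [NormedAddCommGroup E] [NormedSpace ℝ E]
  {H : Type*} [TopologicalSpace H] {I : ModelWithCorners ℝ E H}
  {M : Type*} [TopologicalSpace M] [ChartedSpace H M] {d : ℕ}
  {e : M → EuclideanSpace ℝ (Fin d)}

lemma isSmoothRInf_stdCylinder (he : IsSmoothEmb I e) :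
    IsSmoothRInf (I.prod (𝓡∂ 1)) (stdCylinder e) := by
  refine ⟨⟨d + 1, fun p i hi => stdCylinder_apply_of_gt hi p⟩, fun i => ?_⟩
  have h1 : ContMDiff (I.prod (𝓡∂ 1)) 𝓘(ℝ, ℝ) ∞
      fun q : M × unitInterval => inclRInf d (e q.1) i :=
    ((isSmoothRInf_inclRInf he.1).smooth i).comp contMDiff_fst
  simp only [stdCylinder_apply]
  split_ifs
  · exact h1.add contMDiff_height
  · simpa using h1

lemma stdCylinder_injective (he : IsSmoothEmb I e) : Function.Injective (stdCylinder e) := by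
  intro p q h
  have hc : ∀ i, stdCylinder e p i = stdCylinder e q i := fun i => by rw [h]
  refine Prod.ext (he.2.2.injective ?_) (Subtype.ext ?_)
  · ext i
    simpa [stdCylinder_apply_of_lt i.2] using hc i
  · simpa [stdCylinder_apply_self] using hc d

lemma stdCylinder_immersive [CompactSpace M] (he : IsSmoothEmb I e) (p : M × unitInterval)
    (u : E × EuclideanSpace ℝ (Fin 1))
    (hu : ∀ i, dirDeriv (I.prod (𝓡∂ 1)) (fun q => stdCylinder e q i) p u = 0) : u = 0 := by
  have hs := isSmoothRInf_inclRInf he.1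
  refine Prod.ext ?_ ?_
  · refine (isSmoothEmbRInf_iff.1 ⟨d, e, he, rfl⟩ :
      IsSmoothRInf I (inclRInf d ∘ e) ∧ _).2.2 p.1 u.1 fun i => ?_
    by_cases hi : i < d
    · have h1 := hu i
      simp only [stdCylinder_apply_of_lt hi] at h1
      exact (dirDeriv_fst (hs.mdifferentiableAt i p.1) u).symm.trans h1
    · have : (fun q => (inclRInf d ∘ e) q i) = fun _ => (0 : ℝ) :=
        funext fun q => inclRInf_of_le (not_lt.1 hi) _
      rw [this, dirDeriv_const]
  · have h1 := hu d
    simp only [stdCylinder_apply_self] at h1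
    exact snd_eq_zero_of_dirDeriv_height h1

variable (I e) in
/-- Smooth maps `M × [0,1] → ℝ^∞` with the jets of the standard cylinder along the fixed locus
and with product-like top in the direction `v`. -/
structure IsAdmissible (b : Prop) (φ : M × unitInterval → RInf) (v : RInf) : Prop where
  smooth : IsSmoothRInf (I.prod (𝓡∂ 1)) φ
  fixed : ∀ p ∈ fixedLocus I b, SameJetRInf (I.prod (𝓡∂ 1)) φ (stdCylinder e) p
  top : ∀ x : M, SameJetRInf (I.prod (𝓡∂ 1)) φ (topLine v φ) (x, 1)

variable (I e) in
/-- The embeddings among the admissible maps. -/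
def embSet (b : Prop) : Set (M × unitInterval → RInf) :=
  {φ | IsSmoothEmbRInf (I.prod (𝓡∂ 1)) φ ∧ ∃ v, IsAdmissible I e b φ v}

lemma isAdmissible_stdCylinder (he : IsSmoothEmb I e) (b : Prop) :
    IsAdmissible I e b (stdCylinder e) (Finsupp.single d 1) := by
  refine ⟨isSmoothRInf_stdCylinder he, fun p _ i => .refl _ _, fun x i => ?_⟩
  rw [topLine_stdCylinder]
  exact .refl _ _

/-- The non-tangency clause may be dropped by `productLikeTop_iff`. -/
lemma embSqcupSet_eq [CompactSpace M] [IsManifold I ∞ M] :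
    embSqcupSet I e = embSet I e False := by
  ext φ
  constructor
  · rintro ⟨h, h0, hb, ht⟩
    obtain ⟨v, hv⟩ := (productLikeTop_iff h).1 ht
    refine ⟨h, v, (isSmoothEmbRInf_iff.1 h).1, ?_, hv⟩
    rintro ⟨x, t⟩ (hp | hp | hp)
    · cases hp
      exact h0 x
    · exact hb x hp t
    · exact hp.1.elim
  · rintro ⟨h, v, hv⟩
    exact ⟨h, fun x => hv.fixed _ (Or.inl rfl), fun x hx t => hv.fixed _ (Or.inr (Or.inl hx)),
      (productLikeTop_iff h).2 ⟨v, hv.top⟩⟩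

lemma embBdrySet_eq [CompactSpace M] [IsManifold I ∞ M] :
    embBdrySet I e = embSet I e True := by
  ext φ
  rw [embBdrySet, embSqcupSet_eq]
  constructor
  · rintro ⟨⟨h, v, hv⟩, ht⟩
    refine ⟨h, v, hv.smooth, ?_, hv.top⟩
    rintro ⟨x, t⟩ (hp | hp | hp)
    · exact hv.fixed _ (Or.inl hp)
    · exact hv.fixed _ (Or.inr (Or.inl hp))
    · cases hp.2
      exact ht x
  · rintro ⟨h, v, hv⟩
    refine ⟨⟨h, v, hv.smooth, ?_, hv.top⟩, fun x => hv.fixed _ (Or.inr (Or.inr ⟨trivial, rfl⟩))⟩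
    rintro p (hp | hp | hp)
    · exact hv.fixed _ (Or.inl hp)
    · exact hv.fixed _ (Or.inr (Or.inl hp))
    · exact hp.1.elim

namespace IsAdmissible

variable {b : Prop} {φ ψ : M × unitInterval → RInf} {v w : RInf}

lemma lineComb [IsManifold I ∞ M] (hφ : IsAdmissible I e b φ v) (hψ : IsAdmissible I e b ψ w)
    (he : IsSmoothEmb I e) (s : ℝ) :
    IsAdmissible I e b (fun q => (1 - s) • φ q + s • ψ q) ((1 - s) • v + s • w) := by
  have hē := isSmoothRInf_stdCylinder he
  refine ⟨(hφ.smooth.const_smul _).add (hψ.smooth.const_smul _), fun p hp => ?_, fun x => ?_⟩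
  · have := SameJetRInf.add (hφ.smooth.const_smul (1 - s)) (hē.const_smul (1 - s))
      (hψ.smooth.const_smul s) (hē.const_smul s)
      ((hφ.fixed p hp).const_smul (1 - s) hφ.smooth hē) ((hψ.fixed p hp).const_smul s hψ.smooth hē)
    have e' : (fun q => (1 - s) • stdCylinder e q + s • stdCylinder e q) = stdCylinder e := by
      funext q
      rw [← add_smul, sub_add_cancel, one_smul]
    rwa [e'] at this
  · rw [topLine_lineComb]
    exact SameJetRInf.add (hφ.smooth.const_smul (1 - s)) ((hφ.smooth.topLine v).const_smul (1 - s))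
      (hψ.smooth.const_smul s) ((hψ.smooth.topLine w).const_smul s)
      ((hφ.top x).const_smul (1 - s) hφ.smooth (hφ.smooth.topLine v))
      ((hψ.top x).const_smul s hψ.smooth (hψ.smooth.topLine w))

lemma shift (hφ : IsAdmissible I e b φ v) (K : ℕ) :
    IsAdmissible I e b (fun q => shift d K (φ q)) (ConcordanceEmb.shift d K v) := by
  refine ⟨hφ.smooth.shift d K, fun p hp => ?_, fun x => ?_⟩
  · have := (hφ.fixed p hp).shift d K
    simpa only [shift_stdCylinder] using this
  · rw [topLine_shift]
    exact (hφ.top x).shift d K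

lemma add_flat [IsManifold I ∞ M] {G : M × unitInterval → RInf} (hφ : IsAdmissible I e b φ v)
    (he : IsSmoothEmb I e) (hG : IsSmoothRInf (I.prod (𝓡∂ 1)) G)
    (hG0 : ∀ p ∈ fixedLocus I b, SameJetRInf (I.prod (𝓡∂ 1)) G (fun _ => 0) p)
    (hG1 : ∀ x : M, SameJetRInf (I.prod (𝓡∂ 1)) G (topLine w G) (x, 1)) :
    IsAdmissible I e b (fun q => φ q + G q) (v + w) := by
  refine ⟨hφ.smooth.add hG, fun p hp => ?_, fun x => ?_⟩
  · simpa only [add_zero] using SameJetRInf.add hφ.smooth (isSmoothRInf_stdCylinder he) hG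
      isSmoothRInf_zero (hφ.fixed p hp) (hG0 p hp)
  · have := topLine_lineComb 1 1 v w φ G
    simp only [one_smul] at this
    rw [this]
    exact SameJetRInf.add hφ.smooth (hφ.smooth.topLine v) hG (hG.topLine w) (hφ.top x) (hG1 x)

/-- If the fixed locus meets the top, then the direction at the top is the standard one. -/
lemma direction_apply [IsManifold I ∞ M] (hφ : IsAdmissible I e b φ v) (he : IsSmoothEmb I e)
    {x₀ : M} (hx : (x₀, 1) ∈ fixedLocus I b) : v d = 1 := by
  obtain ⟨w, hw⟩ := exists_dirDeriv_height_eq_one (I := I) x₀ 1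
  have hē := isSmoothRInf_stdCylinder he
  -- The vertical derivative of coordinate `d` at the fixed top point is computed twice: as `1` from
  -- the cylinder and as `v d` from the product-like form.
  have h1 := (hφ.fixed _ hx d).dirDeriv_eq (hφ.smooth.mdifferentiableAt d _)
    (hē.mdifferentiableAt d _) (0, w)
  have h2 := (hφ.top x₀ d).dirDeriv_eq (hφ.smooth.mdifferentiableAt d _)
    ((hφ.smooth.topLine v).mdifferentiableAt d _) (0, w)
  simp only [stdCylinder_apply_self] at h1
  rw [dirDeriv_topLine hφ.smooth, hw, dirDeriv_zero] at h2
  rw [h1, hw] at h2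
  linarith

end IsAdmissible

/-- The straight line from an admissible embedding to its shift consists of embeddings. -/
lemma shift_line_mem [CompactSpace M] [IsManifold I ∞ M] (he : IsSmoothEmb I e) {b : Prop}
    {φ : M × unitInterval → RInf} (hφ : φ ∈ embSet I e b) (K : ℕ) (s : ℝ) :
    (fun p => (1 - s) • φ p + s • shift d K (φ p)) ∈ embSet I e b := by
  obtain ⟨hemb, v, hv⟩ := hφ
  obtain ⟨hs, hinj, him⟩ := isSmoothEmbRInf_iff.1 hemb
  have hadm := hv.lineComb (hv.shift K) he s
  refine ⟨isSmoothEmbRInf_iff.2 ⟨hadm.smooth, fun p q h => hinj ?_, fun p u hu => him p u ?_⟩,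
    _, hadm⟩
  -- The deformation is postcomposition with an injective linear map; the lemma is applied to the
  -- difference of two values here and to a derivative vector below.
  · refine sub_eq_zero.1 (shift_line_eq_zero (d := d) (K := K) (s := s) fun i => ?_)
    have := DFunLike.congr_fun h i
    simp only [Finsupp.add_apply, Finsupp.smul_apply, smul_eq_mul] at this
    simp only [map_sub, Finsupp.sub_apply]
    linarith
  · obtain ⟨w, hw⟩ := hs.exists_dirDeriv p u
    have h0 : w = 0 := shift_line_eq_zero (d := d) (K := K) (s := s) fun i => by
      have h1 := hs.mdifferentiableAt i p
      have h2 := (hs.shift d K).mdifferentiableAt i p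
      have := hu i
      simp only [Finsupp.add_apply, Finsupp.smul_apply, smul_eq_mul] at this
      rw [dirDeriv_lineComb _ _ h1 h2, dirDeriv_shift hw, ← hw] at this
      exact this
    intro i
    rw [← hw, h0]
    rfl

variable (I) in
/-- Maps to the coordinates `d + 1, …, d + K` of `ℝ^∞` that are flat along the fixed locus,
product-like at the top in the direction `w`, and that separate points and (up to a vertical
direction at the top) tangent vectors off the fixed locus. -/
structure IsAuxiliary (d K : ℕ) (b : Prop) (G : M × unitInterval → RInf) (w : RInf) : Prop where
  smooth : IsSmoothRInf (I.prod (𝓡∂ 1)) G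
  low : ∀ q i, i ≤ d → G q i = 0
  high : ∀ q i, d + K < i → G q i = 0
  fixed : ∀ p ∈ fixedLocus I b, SameJetRInf (I.prod (𝓡∂ 1)) G (fun _ => 0) p
  top : ∀ x : M, SameJetRInf (I.prod (𝓡∂ 1)) G (topLine w G) (x, 1)
  separates : ∀ p q, p ∉ fixedLocus I b → G p = G q → p = q
  immersive : ∀ p, p ∉ fixedLocus I b → ∀ u : E × EuclideanSpace ℝ (Fin 1),
    (∀ i, dirDeriv (I.prod (𝓡∂ 1)) (fun q => G q i) p u = 0) →
      u.1 = 0 ∧ (u.2 = 0 ∨ p.2 = 1 ∧ ∃ x₀ : M, (x₀, 1) ∈ fixedLocus I b)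

/-- The auxiliary coordinate with number `j` is placed at index `j + (d + 1)`, just after the
indices used by the cylinder. -/
lemma exists_isAuxiliary [FiniteDimensional ℝ E] [T2Space M] [CompactSpace M]
    [IsManifold I ∞ M] (he : IsSmoothEmb I e) (b : Prop) :
    ∃ K G w, IsAuxiliary (M := M) I d K b G w := by
  obtain ⟨K, g, w, hK, hwK, hg, hfix, htop, hsep, him⟩ := exists_auxiliary_coordinates he b
  let G : M × unitInterval → RInf := fun q => Finsupp.onFinset (Finset.range (d + 1 + K))
    (fun i => if i ≤ d then 0 else g (i - (d + 1)) q) fun i hi => by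
      by_contra h
      have h' : d + 1 + K ≤ i := by simpa using h
      rw [if_neg (by omega), hK _ (by omega)] at hi
      exact hi rfl
  let W : RInf := Finsupp.onFinset (Finset.range (d + 1 + K))
    (fun i => if i ≤ d then 0 else w (i - (d + 1))) fun i hi => by
      by_contra h
      have h' : d + 1 + K ≤ i := by simpa using h
      rw [if_neg (by omega), hwK _ (by omega)] at hi
      exact hi rfl
  have hlow : ∀ q i, i ≤ d → G q i = 0 := fun q i hi => if_pos hi
  have hGq : ∀ j q, G q (j + (d + 1)) = g j q := fun j q => by
    have : G q (j + (d + 1)) = if j + (d + 1) ≤ d then 0 else g (j + (d + 1) - (d + 1)) q := rfl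
    rw [this, if_neg (by omega), Nat.add_sub_cancel]
  have hGi : ∀ j, (fun q => G q (j + (d + 1))) = g j := fun j => funext fun q => hGq j q
  have hWi : ∀ j, W (j + (d + 1)) = w j := fun j => by
    have : W (j + (d + 1)) = if j + (d + 1) ≤ d then 0 else w (j + (d + 1) - (d + 1)) := rfl
    rw [this, if_neg (by omega), Nat.add_sub_cancel]
  have hW0 : ∀ i, i ≤ d → W i = 0 := fun i hi => if_pos hi
  have hG0 : ∀ i, i ≤ d → (fun q => G q i) = fun _ => 0 := fun i hi => funext fun q => hlow q i hi
  have hcases : ∀ i, i ≤ d ∨ ∃ j, i = j + (d + 1) := fun i => by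
    rcases le_or_gt i d with h | h
    · exact Or.inl h
    · exact Or.inr ⟨i - (d + 1), by omega⟩
  have hhigh : ∀ q i, d + K < i → G q i = 0 := fun q i hi => by
    obtain ⟨j, rfl⟩ := (hcases i).resolve_left (by omega)
    rw [hGq, hK j (by omega)]
  refine ⟨K, G, W, ⟨⟨d + K + 1, fun q i hi => hhigh q i hi⟩, fun i => ?_⟩, hlow, hhigh,
    fun p hp i => ?_, fun x i => ?_, fun p q hp h => hsep p q hp fun j => ?_,
    fun p hp u hu => him p hp u fun j => ?_⟩
  · rcases hcases i with hi | ⟨j, rfl⟩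
    · rw [hG0 i hi]
      exact contMDiff_const
    · rw [hGi]
      exact hg j
  · rcases hcases i with hi | ⟨j, rfl⟩
    · rw [hG0 i hi]
      exact .refl _ _
    · rw [hGi]
      exact hfix j p hp
  · rcases hcases i with hi | ⟨j, rfl⟩
    · have : (fun q => topLine W G q i) = fun _ => 0 := by
        funext q
        simp [topLine, hlow _ i hi, hW0 i hi]
      rw [hG0 i hi, this]
      exact .refl _ _
    · have : (fun q => topLine W G q (j + (d + 1))) =
          fun q => g j (q.1, 1) + ((q.2 : ℝ) - 1) * w j := by
        funext q
        simp [topLine, hWi, hGq]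
      rw [hGi, this]
      exact htop j x
  · rw [← hGq, ← hGq, h]
  · rw [← hGi]
    exact hu _

variable {b : Prop} {K : ℕ} {G : M × unitInterval → RInf} {w : RInf}

/-- Adding a multiple of an auxiliary map to the shift of an embedding gives an embedding. -/
lemma IsAuxiliary.shift_add_mem [CompactSpace M] [IsManifold I ∞ M] (hG : IsAuxiliary I d K b G w)
    (he : IsSmoothEmb I e) {φ : M × unitInterval → RInf} (hφ : φ ∈ embSet I e b) (s : ℝ) :
    (fun p => (1 - s) • shift d K (φ p) + s • (shift d K (φ p) + G p)) ∈ embSet I e b := by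
  obtain ⟨hemb, v, hv⟩ := hφ
  obtain ⟨hs, hinj, him⟩ := isSmoothEmbRInf_iff.1 hemb
  have hadm := (hv.shift K).lineComb
    ((hv.shift K).add_flat he hG.smooth hG.fixed hG.top) he s
  -- At the indices hit by the shift `G` vanishes, so every coordinate of `φ` is still present.
  have hcoord : ∀ i p, ((1 - s) • shift d K (φ p) + s • (shift d K (φ p) + G p))
      (if i ≤ d then i else i + K) = φ p i := fun i p => by
    have h0 : G p (if i ≤ d then i else i + K) = 0 := by
      split_ifs with h
      · exact hG.low p i h
      · exact hG.high p _ (by omega)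
    simp only [Finsupp.add_apply, Finsupp.smul_apply, smul_eq_mul, shift_apply_index, h0]
    ring
  refine ⟨isSmoothEmbRInf_iff.2 ⟨hadm.smooth, fun p q h => hinj ?_, fun p u hu => him p u ?_⟩,
    _, hadm⟩
  · ext i
    rw [← hcoord i p, ← hcoord i q]
    exact DFunLike.congr_fun h _
  · intro i
    have := hu (if i ≤ d then i else i + K)
    simpa only [hcoord] using this

/-- An admissible map whose coordinates `d + 1, …, d + K` form an auxiliary map is an embedding. -/
lemma IsAuxiliary.mem_of_coord_eq [CompactSpace M] [IsManifold I ∞ M]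
    (hG : IsAuxiliary I d K b G w) (he : IsSmoothEmb I e) {ψ : M × unitInterval → RInf} {v : RInf}
    (hψ : IsAdmissible I e b ψ v) (hcoord : ∀ q i, d < i → i ≤ d + K → ψ q i = G q i) :
    ψ ∈ embSet I e b := by
  have hout : ∀ i, ¬ (d < i ∧ i ≤ d + K) → ∀ q, G q i = 0 := fun i hi q => by
    rcases le_or_gt i d with h | h
    · exact hG.low q i h
    · exact hG.high q i (by omega)
  refine ⟨isSmoothEmbRInf_iff.2 ⟨hψ.smooth, fun p q h => ?_, fun p u hu => ?_⟩, v, hψ⟩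
  · have hGpq : G p = G q := by
      ext i
      by_cases hi : d < i ∧ i ≤ d + K
      · rw [← hcoord p i hi.1 hi.2, ← hcoord q i hi.1 hi.2, h]
      · rw [hout i hi, hout i hi]
    -- On the fixed locus `ψ` takes the values of the standard cylinder, which is injective; if
    -- either point lies off it, `G` separates the two.
    by_cases hp : p ∈ fixedLocus I b
    · by_cases hq : q ∈ fixedLocus I b
      · refine stdCylinder_injective he ?_
        rw [← (hψ.fixed p hp).apply_eq, ← (hψ.fixed q hq).apply_eq, h]
      · exact (hG.separates q p hq hGpq.symm).symm
    · exact hG.separates p q hp hGpq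
  · by_cases hp : p ∈ fixedLocus I b
    · refine stdCylinder_immersive he p u fun i => ?_
      rw [← (hψ.fixed p hp i).dirDeriv_eq (hψ.smooth.mdifferentiableAt i p)
        ((isSmoothRInf_stdCylinder he).mdifferentiableAt i p), hu]
    · have hGu : ∀ i, dirDeriv (I.prod (𝓡∂ 1)) (fun q => G q i) p u = 0 := fun i => by
        by_cases hi : d < i ∧ i ≤ d + K
        · rw [← hu i]
          congr 1
          funext q
          exact (hcoord q i hi.1 hi.2).symm
        · rw [show (fun q => G q i) = fun _ => 0 from funext (hout i hi), dirDeriv_const]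
      obtain ⟨hu1, hu2 | ⟨hp1, x₀, hx₀⟩⟩ := hG.immersive p hp u hGu
      · exact Prod.ext hu1 hu2
      · refine Prod.ext hu1 (snd_eq_zero_of_dirDeriv_height (I := I) (p := p) ?_)
        obtain ⟨x, t⟩ := p
        obtain rfl : t = 1 := hp1
        -- The one direction `G` may miss is vertical, at the top. There the fixed locus meets the
        -- top, so `v d = 1` and coordinate `d` of `ψ` detects it.
        have h1 := (hψ.top x d).dirDeriv_eq (hψ.smooth.mdifferentiableAt d _)
          ((hψ.smooth.topLine v).mdifferentiableAt d _) u
        rw [hu d, dirDeriv_topLine hψ.smooth, hu1, dirDeriv_zero,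
          hψ.direction_apply he hx₀] at h1
        linarith

/-- Three straight lines join the identity to `shift d K`, to `shift d K + G` and to the constant
`stdCylinder e + G`. Since `G` does not depend on `φ`, the last line forgets `φ` while `G` keeps the
maps embedded. -/
theorem contractibleSpace_embSet [FiniteDimensional ℝ E] [T2Space M] [CompactSpace M]
    [IsManifold I ∞ M] (he : IsSmoothEmb I e) (b : Prop) :
    @ContractibleSpace (embSet I e b) (directLimitTopology (I.prod (𝓡∂ 1)) (embSet I e b)) := by
  let _ := directLimitTopology (I.prod (𝓡∂ 1)) (embSet I e b)
  obtain ⟨K, G, w, hG⟩ := exists_isAuxiliary he b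
  have hē := isAdmissible_stdCylinder he b
  have hēG := hē.add_flat he hG.smooth hG.fixed hG.top
  have hS : ∀ φ ∈ embSet I e b, IsSmoothRInf (I.prod (𝓡∂ 1)) φ :=
    fun φ hφ => (isSmoothEmbRInf_iff.1 hφ.1).1
  -- The coordinates `d + 1, …, d + K` stay equal to those of `G` along this line, because both the
  -- shifted map and the standard cylinder vanish there.
  have hline : ∀ φ ∈ embSet I e b, ∀ s : ℝ,
      (fun p => (1 - s) • (shift d K (φ p) + G p) + s • (stdCylinder e p + G p)) ∈
        embSet I e b := by
    rintro φ ⟨-, v, hv⟩ s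
    refine hG.mem_of_coord_eq he
      (((hv.shift K).add_flat he hG.smooth hG.fixed hG.top).lineComb hēG he s) fun q i h1 h2 => ?_
    simp only [Finsupp.add_apply, Finsupp.smul_apply, smul_eq_mul, stdCylinder_apply_of_gt h1,
      shift_apply, if_neg (not_le.2 h1), if_pos h2]
    ring
  have hconst : (fun p => stdCylinder e p + G p) ∈ embSet I e b := by
    refine hG.mem_of_coord_eq he hēG fun q i h1 _ => ?_
    simp [stdCylinder_apply_of_gt h1]
  obtain ⟨f₀, f₁, hf₀, hf₁, hf⟩ := exists_homotopic_line hS LinearMap.id (shift d K)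
    isSmoothRInf_zero isSmoothRInf_zero fun φ hφ s => by
      simpa using shift_line_mem he hφ K s
  obtain ⟨g₀, g₁, hg₀, hg₁, hg⟩ := exists_homotopic_line hS (shift d K) (shift d K)
    isSmoothRInf_zero hG.smooth fun φ hφ s => by
      simpa only [add_zero] using hG.shift_add_mem he hφ s
  obtain ⟨h₀, h₁, hh₀, hh₁, hh⟩ := exists_homotopic_line hS (shift d K) 0
    hG.smooth hēG.smooth fun φ hφ s => by
      simpa only [LinearMap.zero_apply, zero_add] using hline φ hφ s
  have e₀ : f₀ = ContinuousMap.id _ :=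
    ContinuousMap.ext fun φ => Subtype.ext (by rw [hf₀]; simp)
  have e₁ : f₁ = g₀ := ContinuousMap.ext fun φ => Subtype.ext (by rw [hf₁, hg₀])
  have e₂ : g₁ = h₀ := ContinuousMap.ext fun φ => Subtype.ext (by rw [hg₁, hh₀])
  have e₃ : h₁ = ContinuousMap.const _ ⟨_, hconst⟩ :=
    ContinuousMap.ext fun φ => Subtype.ext (by rw [hh₁]; simp)
  rw [contractible_iff_id_nullhomotopic]
  refine ⟨⟨_, hconst⟩, ?_⟩
  rw [← e₀, ← e₃]
  exact (hf.trans (e₁ ▸ hg)).trans (e₂ ▸ hh)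

end Contraction

end ConcordanceEmb

end

theorem mainTheorem8
    {E : Type*} [NormedAddCommGroup E] [NormedSpace ℝ E] [FiniteDimensional ℝ E]
    {H : Type*} [TopologicalSpace H] (I : ModelWithCorners ℝ E H)
    {M : Type*} [TopologicalSpace M] [T2Space M] [CompactSpace M]
    [ChartedSpace H M] [IsManifold I ∞ M]
    {d : ℕ} (e : M → EuclideanSpace ℝ (Fin d)) (he : ConcordanceEmb.IsSmoothEmb I e) :
    ContractibleSpace (ConcordanceEmb.EmbSqcup I e) ∧
      ContractibleSpace (ConcordanceEmb.EmbBdry I e) := by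
  constructor
  · have h := ConcordanceEmb.contractibleSpace_embSet he False
    rw [← ConcordanceEmb.embSqcupSet_eq] at h
    exact h
  · have h := ConcordanceEmb.contractibleSpace_embSet he True
    rw [← ConcordanceEmb.embBdrySet_eq] at h
    exact h
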